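/- **Definitions.** A *singular semi-Riemannian manifold* $(M,g)$ is a smooth manifold $M$ with a smooth field $g=\langle\cdot,\cdot\rangle$ of symmetric bilinear forms on its tangent spaces, which may be degenerate and may change signature. It is a *singular almost product semi-Riemannian manifold* $(M,g,J)$ if moreover $J:TM\to TM$ is a smooth bundle endomorphism with $J^2=\mathrm{id}$ and $g(JX,JY)=g(X,Y)$. Let $$\mathcal K(X,Y,Z)=\tfrac12\{X\langle Y,Z\rangle+Y\langle Z,X\rangle-Z\langle X,Y\rangle-\langle X,[Y,Z]\rangle+\langle Y,[Z,X]\rangle+\langle Z,[X,Y]\rangle\},$$ $$\widetilde{\mathcal K}(X,Y,Z)=\tfrac12[\mathcal K(X,Y,Z)+\mathcal K(X,JY,JZ)],$$ and let $\nabla^\flat_XY=\mathcal K(X,Y,\cdot)$ and $\widetilde\nabla^\flat_XY=\widetilde{\mathcal K}(X,Y,\cdot)$, which are smooth $1$-forms for $X,Y\in\Gamma(TM)$. Let $\mathcal A^\bullet(M)$ be the set of smooth $1$-forms $\omega$ such that for every $p\in M$ there is $v\in T_pM$ with $\omega_p=g_p(v,\cdot)$; if $\omega_p=g_p(v,\cdot)$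 and $\tau_p=g_p(w,\cdot)$, put $\langle\langle\omega,\tau\rangle\rangle_\bullet(p)=g_p(v,w)$, and write $\widetilde{\mathcal K}(X,Y,\bullet)\widetilde{\mathcal K}(Z,T,\bullet)=\langle\langle\widetilde\nabla^\flat_XY,\widetilde\nabla^\flat_ZT\rangle\rangle_\bullet$. When all $\widetilde\nabla^\flat_XY$ lie in $\mathcal A^\bullet(M)$, put, for $\omega\in\mathcal A^\bullet(M)$, $$(\widetilde\nabla_X\omega)(Y)=X(\omega(Y))-\langle\langle\widetilde\nabla^\flat_XY,\omega\rangle\rangle_\bullet .$$ The *regions of constant signature* are formed by the points near which the signature of $g$ is constant; they make up an open dense set $M_{\mathrm{reg}}$. The $1$-form $\widetilde\nabla_X\omega$ is considered on $M_{\mathrm{reg}}$, and $\widetilde\nabla_X\omega\in\mathcal A^\bullet(M)$ means that it extends from $M_{\mathrm{reg}}$ to a $1$-form in $\mathcal A^\bullet(M)$. $(M,g)$ is *radical-stationary* if $\nabla^\flat_XY\in\mathcal A^\bullet(M)$ for all $X,Y\in\Gamma(TM)$. A singular almost product semi-Riemannian manifold $(M,g,J)$ is *almost product semi-regular* if $\widetilde\nabla^\flat_XY\in\mathcal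 A^\bullet(M)$ and $\widetilde\nabla_Z(\widetilde\nabla^\flat_XY)\in\mathcal A^\bullet(M)$ for all $X,Y,Z\in\Gamma(TM)$. **Theorem 4.16.** Let $(B,g_B,J_1)$ be a singular almost product semi-Riemannian manifold with $g_B$ non-degenerate at every point, let $(F,g_F,J_2)$ be an almost product semi-regular semi-Riemannian manifold, and let $f\in C^\infty(B)$ (zeros of $f$ are allowed). Let $B\times_fF$ be the manifold $B\times F$ with the metric $\pi_B^*g_B+(f\circ\pi_B)^2\pi_F^*g_F$, where $\pi_B,\pi_F$ are the projections, and let $J=(J_1,J_2)$. Then $(B\times_fF,J)$ is an almost product semi-regular semi-Riemannian manifold. If moreover $(F,g_F)$ is radical-stationary, then so is $B\times_fF$. Furthermore, for all vector fields $X,Y,Z,T\in\Gamma(T(B\times F))$ the contraction $\widetilde{\mathcal K}(X,Y,\bullet)\widetilde{\mathcal K}(Z,T,\bullet)$ extends from the regions of constant signature of $B\times_fF$ to a smooth function on $B\times F$. -/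

import Mathlib

open scoped Manifold ContDiff Topology

noncomputable section

namespace SingularGeometry

section General

variable {E : Type*} [NormedAddCommGroup E] [NormedSpace ℝ E]
  {H : Type*} [TopologicalSpace H] (I : ModelWithCorners ℝ E H)
  {M : Type*} [TopologicalSpace M] [ChartedSpace H M]

/-- A (not necessarily smooth) vector field on `M`. -/
abbrev VField (M : Type*) [TopologicalSpace M] [ChartedSpace H M] := ∀ p : M, TangentSpace I p

/-- A (not necessarily smooth) field of covectors on `M`. -/
abbrev CovField (M : Type*) [TopologicalSpace M] [ChartedSpace H M] :=
  ∀ p : M, TangentSpace I p →L[ℝ] ℝ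

/-- A (not necessarily smooth) field of bilinear forms on the tangent spaces of `M`. -/
abbrev BilinField (M : Type*) [TopologicalSpace M] [ChartedSpace H M] :=
  ∀ p : M, TangentSpace I p →L[ℝ] TangentSpace I p →L[ℝ] ℝ

/-- A (not necessarily smooth) field of endomorphisms of the tangent spaces of `M`. -/
abbrev EndField (M : Type*) [TopologicalSpace M] [ChartedSpace H M] :=
  ∀ p : M, TangentSpace I p →L[ℝ] TangentSpace I p

/-- `X ∈ Γ(TM)`: the vector field `X` is smooth. -/
def IsSmoothVF [IsManifold I ∞ M] (X : VField I M) : Prop :=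
  ContMDiff I (I.prod 𝓘(ℝ, E)) ∞ (fun p => Bundle.TotalSpace.mk' E p (X p))

/-- `α ∈ A¹(M)`: the field of covectors `α` is a smooth `1`-form. -/
def IsSmoothOneForm [IsManifold I ∞ M] (α : CovField I M) : Prop :=
  ContMDiff I (I.prod 𝓘(ℝ, E →L[ℝ] ℝ)) ∞
    (fun p => Bundle.TotalSpace.mk' (E →L[ℝ] ℝ)
      (E := fun q : M => (TangentSpace I q →L[ℝ] ℝ)) p (α p))

/-- `(M, g)` is a singular semi-Riemannian manifold: `g` is a smooth field of symmetric bilinear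
forms, which may be degenerate and may change signature from point to point. -/
structure IsSingularMetric [IsManifold I ∞ M] (g : BilinField I M) : Prop where
  symm : ∀ (p : M) (v w : TangentSpace I p), g p v w = g p w v
  smooth : ContMDiff I (I.prod 𝓘(ℝ, E →L[ℝ] E →L[ℝ] ℝ)) ∞
    (fun p => Bundle.TotalSpace.mk' (E →L[ℝ] E →L[ℝ] ℝ)
      (E := fun q : M =>
        (TangentSpace I q →L[ℝ] TangentSpace I q →L[ℝ] ℝ)) p (g p))

/-- `(M, g, J)` is a singular almost product semi-Riemannian manifold: `g` is a singular metric and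
`J` is a smooth field of endomorphisms with `J² = id` and `g(JX, JY) = g(X, Y)`. -/
structure IsAlmostProduct [IsManifold I ∞ M] (g : BilinField I M) (J : EndField I M) : Prop where
  metric : IsSingularMetric I g
  smooth : ContMDiff I (I.prod 𝓘(ℝ, E →L[ℝ] E)) ∞
    (fun p => Bundle.TotalSpace.mk' (E →L[ℝ] E)
      (E := fun q : M => (TangentSpace I q →L[ℝ] TangentSpace I q)) p (J p))
  involutive : ∀ (p : M) (v : TangentSpace I p), J p (J p v) = v
  isometric : ∀ (p : M) (v w : TangentSpace I p), g p (J p v) (J p w) = g p v w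

/-- The metric `g` is non-degenerate at every point. -/
def IsNondegenerate (g : BilinField I M) : Prop :=
  ∀ (p : M) (v : TangentSpace I p), (∀ w : TangentSpace I p, g p v w = 0) → v = 0

/-- The derivative `X(h)` of the function `h` in the direction of the vector field `X`. -/
def dirDeriv (X : VField I M) (h : M → ℝ) : M → ℝ :=
  fun p => mvfderiv I h p (X p)

/-- The function `⟨X, Y⟩ = g(X, Y)`. -/
def pairing (g : BilinField I M) (X Y : VField I M) : M → ℝ :=
  fun p => g p (X p) (Y p)

/-- The Koszul form
`K(X,Y,Z) = ½ {X⟨Y,Z⟩ + Y⟨Z,X⟩ - Z⟨X,Y⟩ - ⟨X,[Y,Z]⟩ + ⟨Y,[Z,X]⟩ + ⟨Z,[X,Y]⟩}`. -/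
def koszul (g : BilinField I M) (X Y Z : VField I M) : M → ℝ := fun p =>
  (1 / 2 : ℝ) *
    (dirDeriv I X (pairing I g Y Z) p + dirDeriv I Y (pairing I g Z X) p
      - dirDeriv I Z (pairing I g X Y) p
      - pairing I g X (VectorField.mlieBracket I Y Z) p
      + pairing I g Y (VectorField.mlieBracket I Z X) p
      + pairing I g Z (VectorField.mlieBracket I X Y) p)

/-- The almost product Koszul form `K̃(X,Y,Z) = ½ [K(X,Y,Z) + K(X,JY,JZ)]`. -/
def apKoszul (g : BilinField I M) (J : EndField I M) (X Y Z : VField I M) : M → ℝ := fun p =>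
  (1 / 2 : ℝ) *
    (koszul I g X Y Z p + koszul I g X (fun q => J q (Y q)) (fun q => J q (Z q)) p)

open Classical in
/-- The covector at `p` induced by a function `Φ` of vector fields, that is, the covector `α` at `p`
with `α (Z p) = Φ Z` for all smooth vector fields `Z`. It exists (and is then unique) if and only if
`Φ Z` depends linearly on the value of the smooth field `Z` at `p` only; otherwise the value is `0`.
-/
def toCovector [IsManifold I ∞ M] (p : M) (Φ : VField I M → ℝ) : TangentSpace I p →L[ℝ] ℝ :=
  if h : ∃ α : TangentSpace I p →L[ℝ] ℝ, ∀ Z : VField I M, IsSmoothVF I Z → α (Z p) = Φ Z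
  then h.choose else 0

/-- The lower covariant derivative `∇♭_X Y`, the `1`-form `Z ↦ K(X,Y,Z)`. -/
def lowerDeriv [IsManifold I ∞ M] (g : BilinField I M) (X Y : VField I M) : CovField I M :=
  fun p => toCovector I p (fun Z => koszul I g X Y Z p)

/-- The almost product lower covariant derivative `∇̃♭_X Y`, the `1`-form `Z ↦ K̃(X,Y,Z)`. -/
def apLowerDeriv [IsManifold I ∞ M] (g : BilinField I M) (J : EndField I M) (X Y : VField I M) :
    CovField I M :=
  fun p => toCovector I p (fun Z => apKoszul I g J X Y Z p)

/-- `α ∈ A^•(M)`: `α` is a smooth `1`-form whose value at each point `p` is of the form `g_p(v, ·)`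
for some tangent vector `v` at `p`. -/
def IsLowered [IsManifold I ∞ M] (g : BilinField I M) (α : CovField I M) : Prop :=
  IsSmoothOneForm I α ∧ ∀ p : M, ∃ v : TangentSpace I p, α p = g p v

open Classical in
/-- The inner product `⟪α, τ⟫_•` of two covectors `α = g(v, ·)` and `τ = g(w, ·)` at `p`, namely
`g(v, w)`; this does not depend on the choice of `v` and `w`. (The value is `0` if `α` or `τ` is not
of this form.) -/
def coInner (g : BilinField I M) (p : M) (α τ : TangentSpace I p →L[ℝ] ℝ) : ℝ :=
  if h : (∃ v : TangentSpace I p, α = g p v) ∧ (∃ w : TangentSpace I p, τ = g p w)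
  then g p h.1.choose h.2.choose else 0

/-- The contraction `K̃(X,Y,•) K̃(Z,T,•) = ⟪∇̃♭_X Y, ∇̃♭_Z T⟫_•`. -/
def apContraction [IsManifold I ∞ M] (g : BilinField I M) (J : EndField I M)
    (X Y Z T : VField I M) : M → ℝ :=
  fun p => coInner I g p (apLowerDeriv I g J X Y p) (apLowerDeriv I g J Z T p)

/-- The almost product covariant derivative
`(∇̃_X α)(Y) = X(α(Y)) - ⟪∇̃♭_X Y, α⟫_•` of a `1`-form `α`, as a function of the vector field `Y`.
-/
def apCovDeriv [IsManifold I ∞ M] (g : BilinField I M) (J : EndField I M)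
    (X : VField I M) (α : CovField I M) (Y : VField I M) : M → ℝ :=
  fun p => dirDeriv I X (fun q => α q (Y q)) p - coInner I g p (apLowerDeriv I g J X Y p) (α p)

/-- The quadratic form `v ↦ g_p(v, v)` on the tangent space at `p`. -/
def quadForm (g : BilinField I M) (p : M) : QuadraticForm ℝ (TangentSpace I p) :=
  LinearMap.BilinMap.toQuadraticMap (g p).toLinearMap₁₂

/-- The union of the regions of constant signature of `g`: the points near which the numbers of
positive and of negative squares of `g` are constant. It is an open dense set. -/
def constSignature (g : BilinField I M) : Set M :=
  {p | ∀ᶠ q in 𝓝 p, sigPos (quadForm I g q) = sigPos (quadForm I g p) ∧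
    sigNeg (quadForm I g q) = sigNeg (quadForm I g p)}

/-- `Φ ∈ A^•(M)` for an element `Φ` of `A¹_d(M)`, a `1`-form (given by its values on vector fields)
of which only the restriction to the regions of constant signature is significant: `Φ` extends
from these regions to a `1`-form in `A^•(M)`. -/
def ExtendsToLowered [IsManifold I ∞ M] (g : BilinField I M) (Φ : VField I M → M → ℝ) : Prop :=
  ∃ η : CovField I M, IsLowered I g η ∧
    ∀ T : VField I M, IsSmoothVF I T → ∀ p ∈ constSignature I g, η p (T p) = Φ T p

/-- `(M, g)` is radical-stationary: `∇♭_X Y ∈ A^•(M)` for all `X, Y ∈ Γ(TM)`. -/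
def IsRadicalStationary [IsManifold I ∞ M] (g : BilinField I M) : Prop :=
  ∀ X Y : VField I M, IsSmoothVF I X → IsSmoothVF I Y → IsLowered I g (lowerDeriv I g X Y)

/-- `(M, g, J)` is an almost product semi-regular semi-Riemannian manifold: a singular almost
product semi-Riemannian manifold with `∇̃♭_X Y ∈ A^•(M)` and `∇̃_Z (∇̃♭_X Y) ∈ A^•(M)` for all
`X, Y, Z ∈ Γ(TM)`. -/
structure IsAPSemiRegular [IsManifold I ∞ M] (g : BilinField I M) (J : EndField I M) : Prop where
  almostProduct : IsAlmostProduct I g J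
  lower : ∀ X Y : VField I M, IsSmoothVF I X → IsSmoothVF I Y →
    IsLowered I g (apLowerDeriv I g J X Y)
  second : ∀ X Y Z : VField I M, IsSmoothVF I X → IsSmoothVF I Y → IsSmoothVF I Z →
    ExtendsToLowered I g (apCovDeriv I g J Z (apLowerDeriv I g J X Y))

end General

section Warped

variable {E : Type*} [NormedAddCommGroup E] [NormedSpace ℝ E]
  {H : Type*} [TopologicalSpace H] (I : ModelWithCorners ℝ E H)
  {E' : Type*} [NormedAddCommGroup E'] [NormedSpace ℝ E']
  {H' : Type*} [TopologicalSpace H'] (I' : ModelWithCorners ℝ E' H')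
  {B : Type*} [TopologicalSpace B] [ChartedSpace H B]
  {F : Type*} [TopologicalSpace F] [ChartedSpace H' F]

/-- The pullback `(v, w) ↦ b(Av, Aw)` of a bilinear form `b` under a linear map `A`. -/
def pullbackForm {V W : Type*} [AddCommGroup V] [Module ℝ V] [TopologicalSpace V]
    [AddCommGroup W] [Module ℝ W] [TopologicalSpace W]
    (b : W →L[ℝ] W →L[ℝ] ℝ) (A : V →L[ℝ] W) : V →L[ℝ] V →L[ℝ] ℝ :=
  (ContinuousLinearMap.precomp ℝ A).comp (b.comp A)

/-- The metric `π_B^* g_B + (f ∘ π_B)² π_F^* g_F` of the warped product `B ×_f F`. -/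
def warpedMetric (gB : BilinField I B) (gF : BilinField I' F) (f : B → ℝ) :
    BilinField (I.prod I') (B × F) := fun x =>
  pullbackForm (gB x.1) (mfderiv (I.prod I') I Prod.fst x) +
    (f x.1) ^ 2 • pullbackForm (gF x.2) (mfderiv (I.prod I') I' Prod.snd x)

/-- The almost product structure `J = (J₁, J₂)` on `T(B × F) = TB × TF`. -/
def prodStructure (J₁ : EndField I B) (J₂ : EndField I' F) :
    EndField (I.prod I') (B × F) := fun x =>
  (J₁ x.1).prodMap (J₂ x.2)

end Warped

end SingularGeometry

end

/-! The Koszul forms are local in their arguments, and are function-linear up to Leibniz terms built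
from `g(Y, ·)`. The lifts `(V, W)` of fields on `B` and `F` generate the smooth fields on `B × F`
locally over the smooth functions, so everything reduces to lifts (`prodLift_induction`). On lifts,
brackets have no mixed terms and the Koszul formula becomes explicit. `apLowerDeriv_prodLift` writes
`∇̃♭` as a form pulled back from `B`, plus `f²` times the fiber's `∇̃♭`, plus multiples of forms `f
g_F(W, ·)`, plus `-f` times `gradForm`, a combination of the base forms `df` and `df ∘ J₁` with
coefficients from the fiber.

Each summand lies in the image of the warped metric. Base covectors can be raised because `g_B` is
non-degenerate. If `α = g_F(w, ·)`, then `f α` is raised by `f⁻¹ w` where `f ≠ 0` and is zero where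
`f = 0` (`lowered_smul_sndForm`). This is why no fiber form may occur without a factor `f`.

The second derivative is extended summand by summand. A base form is `Y♭` for a smooth lift `Y`, and
metric compatibility gives `∇̃_Z Y♭ = ∇̃♭_Z Y`. For `f g_F(W, ·)` the factor `1/f` of the raised
vector cancels against the factor `f` of `∇̃♭`, and a smooth expression remains
(`covDerivExtendsAt_smul_sndForm_lowering`). For `f² κ` with `κ` a fiber derivative, the
second-order hypothesis on `F` enters (`covDerivExtendsAt_sq_smul_sndForm`).

These formulas are derived where `f ≠ 0`. At a zero of `f` lying in a region of constant signature,
either `f` vanishes nearby or `g_F` is zero at the fiber point, since otherwise the rank would jump.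
So `df ⊗ g_F = 0` there (`mvfderiv_mul_eq_zero_of_mem_constSignature`), and the formulas persist.
The local extensions are glued by a partition of unity. Contractions are obtained by solving the
definition of `∇̃_Z` for the inner product, and radical-stationarity is the first-order statement
for `J = id`. -/

noncomputable section

namespace SingularGeometry

set_option linter.unusedSectionVars false

open Bundle VectorField

/-! ### Extending local sections, testing smoothness on fields, local frames -/

section Sections

variable {E : Type*} [NormedAddCommGroup E] [NormedSpace ℝ E]
  {H : Type*} [TopologicalSpace H] {I : ModelWithCorners ℝ E H}
  {M : Type*} [TopologicalSpace M] [ChartedSpace H M]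

/-- A section of a bundle that is smooth near a point agrees near this point with a section that is
smooth everywhere. -/
lemma exists_smooth_section_eventuallyEq [FiniteDimensional ℝ E] [T2Space M] [IsManifold I ∞ M]
    {F : Type*} [NormedAddCommGroup F] [NormedSpace ℝ F]
    {V : M → Type*} [TopologicalSpace (TotalSpace F V)] [∀ x, AddCommGroup (V x)]
    [∀ x, Module ℝ (V x)] [∀ x, TopologicalSpace (V x)] [FiberBundle F V] [VectorBundle ℝ F V]
    {u : Set M} (hu : IsOpen u) {p : M} (hp : p ∈ u) {s : ∀ x, V x}
    (hs : ContMDiffOn I (I.prod 𝓘(ℝ, F)) ∞ (fun x => TotalSpace.mk' F x (s x)) u) :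
    ∃ s' : ∀ x, V x, ContMDiff I (I.prod 𝓘(ℝ, F)) ∞ (fun x => TotalSpace.mk' F x (s' x)) ∧
      ∀ᶠ x in 𝓝 p, s' x = s x := by
  obtain ⟨ψ, -, hψ⟩ :=
    (SmoothBumpFunction.nhds_basis_tsupport (I := I) p).mem_iff.1 (hu.mem_nhds hp)
  refine ⟨(ψ : M → ℝ) • s,
    ContMDiffOn.smul_section_of_tsupport ψ.contMDiff.contMDiffOn hu hψ hs, ?_⟩
  filter_upwards [ψ.eventuallyEq_one] with x hx
  simp [hx]

/-- Smoothness of a field of linear maps can be tested on smooth vector fields. -/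
lemma contMDiffAt_hom_of_apply [FiniteDimensional ℝ E] [T2Space M] [IsManifold I ∞ M]
    {F : Type*} [NormedAddCommGroup F] [NormedSpace ℝ F]
    {V : M → Type*} [TopologicalSpace (TotalSpace F V)] [∀ x, AddCommGroup (V x)]
    [∀ x, Module ℝ (V x)] [∀ x, TopologicalSpace (V x)] [FiberBundle F V] [VectorBundle ℝ F V]
    [∀ x, IsTopologicalAddGroup (V x)] [∀ x, ContinuousSMul ℝ (V x)]
    {p : M} {φ : ∀ x : M, TangentSpace I x →L[ℝ] V x}
    (h : ∀ X : VField I M, IsSmoothVF I X →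
      ContMDiffAt I (I.prod 𝓘(ℝ, F)) ∞ (fun x => TotalSpace.mk' F x (φ x (X x))) p) :
    ContMDiffAt I (I.prod 𝓘(ℝ, E →L[ℝ] F)) ∞
      (fun x => TotalSpace.mk' (E →L[ℝ] F) (E := fun x : M => TangentSpace I x →L[ℝ] V x)
        x (φ x)) p := by
  rw [contMDiffAt_hom_bundle]
  refine ⟨contMDiffAt_id, ?_⟩
  let b := Module.finBasis ℝ E
  set e := trivializationAt E (TangentSpace I) p with he
  set e' := trivializationAt F V p with he'
  have hpe : p ∈ e.baseSet := FiberBundle.mem_baseSet_trivializationAt E (TangentSpace I) p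
  have hpe' : p ∈ e'.baseSet := FiberBundle.mem_baseSet_trivializationAt F V p
  have key : ∀ i, ContMDiffAt I 𝓘(ℝ, F) ∞ (fun x =>
      ContinuousLinearMap.inCoordinates E (TangentSpace I) F V p x p x (φ x) (b i)) p := by
    intro i
    -- The hypothesis speaks only of globally smooth fields, so the local frame field is first
    -- replaced by a global one with the same germ at `p`.
    obtain ⟨s, hs, hse⟩ := exists_smooth_section_eventuallyEq e.open_baseSet hpe
      (e.contMDiffOn_localFrame_baseSet (I := I) ∞ b i)
    have := (contMDiffAt_section _).1 (h s hs)
    refine this.congr_of_eventuallyEq ?_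
    filter_upwards [hse, e.open_baseSet.mem_nhds hpe, e'.open_baseSet.mem_nhds hpe']
      with x hx hxe hxe'
    rw [ContinuousLinearMap.inCoordinates_eq hxe hxe', hx]
    simp [hxe, Trivialization.basisAt, ← he, ← he']
  -- In coordinates the map is `∑ bᵢ* ⊗ φ(bᵢ)`, so smoothness of its columns suffices; this uses
  -- that `E` is finite-dimensional.
  have hsum : ∀ x, ContinuousLinearMap.inCoordinates E (TangentSpace I) F V p x p x (φ x) =
      ∑ i, (b.coord i).toContinuousLinearMap.smulRight
        (ContinuousLinearMap.inCoordinates E (TangentSpace I) F V p x p x (φ x) (b i)) := by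
    intro x
    ext v
    conv_lhs => rw [← b.sum_repr v, map_sum]
    simp [map_smul]
  refine ContMDiffAt.congr_of_eventuallyEq ?_ (Filter.Eventually.of_forall hsum)
  refine ContMDiffAt.sum fun i _ => ?_
  exact ((ContinuousLinearMap.smulRightL ℝ E F
    (b.coord i).toContinuousLinearMap).contMDiff.contMDiffAt).comp p (key i)

variable [FiniteDimensional ℝ E] [T2Space M] [IsManifold I ∞ M]

lemma contMDiff_trivial_iff {h : M → ℝ} :
    ContMDiff I (I.prod 𝓘(ℝ, ℝ)) ∞
      (fun x => TotalSpace.mk' ℝ (E := fun _ : M => ℝ) x (h x)) ↔ ContMDiff I 𝓘(ℝ, ℝ) ∞ h :=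
  forall_congr' fun _ => contMDiffAt_section _

lemma contMDiffAt_trivial_iff {h : M → ℝ} {p : M} :
    ContMDiffAt I (I.prod 𝓘(ℝ, ℝ)) ∞
      (fun x => TotalSpace.mk' ℝ (E := fun _ : M => ℝ) x (h x)) p ↔ ContMDiffAt I 𝓘(ℝ, ℝ) ∞ h p :=
  contMDiffAt_section _

lemma IsSmoothOneForm.apply {α : CovField I M} (hα : IsSmoothOneForm I α) {X : VField I M}
    (hX : IsSmoothVF I X) : ContMDiff I 𝓘(ℝ, ℝ) ∞ (fun p => α p (X p)) :=
  contMDiff_trivial_iff.1 (ContMDiff.clm_bundle_apply hα hX)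

lemma isSmoothOneForm_iff {α : CovField I M} : IsSmoothOneForm I α ↔
    ∀ X : VField I M, IsSmoothVF I X → ContMDiff I 𝓘(ℝ, ℝ) ∞ (fun p => α p (X p)) :=
  ⟨fun hα _ hX => hα.apply hX, fun h p => contMDiffAt_hom_of_apply (V := fun _ : M => ℝ)
    fun X hX => contMDiffAt_trivial_iff.2 (h X hX p)⟩

lemma contMDiff_endField_iff {J : EndField I M} :
    ContMDiff I (I.prod 𝓘(ℝ, E →L[ℝ] E)) ∞
      (fun p => TotalSpace.mk' (E →L[ℝ] E)
        (E := fun q : M => (TangentSpace I q →L[ℝ] TangentSpace I q)) p (J p)) ↔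
    ∀ X : VField I M, IsSmoothVF I X → IsSmoothVF I (fun p => J p (X p)) :=
  ⟨fun hJ _ hX => ContMDiff.clm_bundle_apply hJ hX, fun h p => contMDiffAt_hom_of_apply
    (V := TangentSpace I) fun X hX => h X hX p⟩

lemma contMDiff_bilinField_iff {g : BilinField I M} :
    ContMDiff I (I.prod 𝓘(ℝ, E →L[ℝ] E →L[ℝ] ℝ)) ∞
      (fun p => TotalSpace.mk' (E →L[ℝ] E →L[ℝ] ℝ)
        (E := fun q : M => (TangentSpace I q →L[ℝ] TangentSpace I q →L[ℝ] ℝ)) p (g p)) ↔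
    ∀ X Y : VField I M, IsSmoothVF I X → IsSmoothVF I Y →
      ContMDiff I 𝓘(ℝ, ℝ) ∞ (pairing I g X Y) := by
  refine ⟨fun hg X Y hX hY => ?_, fun h p => ?_⟩
  · exact IsSmoothOneForm.apply (α := fun p => g p (X p)) (ContMDiff.clm_bundle_apply hg hX) hY
  · refine contMDiffAt_hom_of_apply (V := fun q : M => (TangentSpace I q →L[ℝ] ℝ)) fun X hX => ?_
    exact (isSmoothOneForm_iff (α := fun p => g p (X p))).2 (fun Y hY => h X Y hX hY) p

instance (p : M) : T2Space (TangentSpace I p) := inferInstanceAs (T2Space E)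

instance (p : M) : FiniteDimensional ℝ (TangentSpace I p) :=
  inferInstanceAs (FiniteDimensional ℝ E)

/-- Near every point there are a smooth frame and its smooth dual coframe, both extended to the
whole manifold. -/
lemma exists_frame (p : M) : ∃ (s : Fin (Module.finrank ℝ E) → VField I M)
    (θ : Fin (Module.finrank ℝ E) → CovField I M),
    (∀ i, IsSmoothVF I (s i)) ∧ (∀ i, IsSmoothOneForm I (θ i)) ∧
    ∀ᶠ q in 𝓝 p, ∀ v : TangentSpace I q, v = ∑ i, θ i q v • s i q := by
  let b := Module.finBasis ℝ E
  let e := trivializationAt E (TangentSpace I) p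
  have hpe : p ∈ e.baseSet := FiberBundle.mem_baseSet_trivializationAt E (TangentSpace I) p
  choose s hs hse using fun i => exists_smooth_section_eventuallyEq e.open_baseSet hpe
      (e.contMDiffOn_localFrame_baseSet (I := I) ∞ b i)
  let θ₀ : Fin (Module.finrank ℝ E) → CovField I M := fun i q =>
    LinearMap.toContinuousLinearMap (e.localFrameCoeff I b i q)
  have hθ₀ : ∀ i, ContMDiffOn I (I.prod 𝓘(ℝ, E →L[ℝ] ℝ)) ∞
    (fun p => Bundle.TotalSpace.mk' (E →L[ℝ] ℝ)
      (E := fun q : M => (TangentSpace I q →L[ℝ] ℝ)) p (θ₀ i p)) e.baseSet := fun i q hq =>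
    (contMDiffAt_hom_of_apply (V := fun _ : M => ℝ) fun X hX => contMDiffAt_trivial_iff.2
      (contMDiffAt_localFrameCoeff b hq (hX q) i)).contMDiffWithinAt
  choose θ hθ hθe using fun i => exists_smooth_section_eventuallyEq e.open_baseSet hpe (hθ₀ i)
  refine ⟨s, θ, hs, hθ, ?_⟩
  filter_upwards [Filter.eventually_all.2 hse, Filter.eventually_all.2 hθe,
    e.open_baseSet.mem_nhds hpe] with q h₁ h₂ hq v
  simp_rw [h₁, h₂]
  exact e.eq_sum_localFrameCoeff_smul (I := I) (b := b) (s := fun _ => v) hq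

end Sections

/-! ### Tensoriality: function-linear operations on fields are covectors -/

section Tensoriality

variable {E : Type*} [NormedAddCommGroup E] [NormedSpace ℝ E]
  {H : Type*} [TopologicalSpace H] {I : ModelWithCorners ℝ E H}
  {M : Type*} [TopologicalSpace M] [ChartedSpace H M] [IsManifold I ∞ M]

lemma IsSmoothVF.add {X Y : VField I M} (hX : IsSmoothVF I X) (hY : IsSmoothVF I Y) :
    IsSmoothVF I (X + Y) :=
  ContMDiff.add_section hX hY

lemma IsSmoothVF.smul {h : M → ℝ} {X : VField I M} (hh : ContMDiff I 𝓘(ℝ, ℝ) ∞ h)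
    (hX : IsSmoothVF I X) : IsSmoothVF I (h • X) :=
  ContMDiff.smul_section hh hX

lemma isSmoothVF_zero : IsSmoothVF I (0 : VField I M) :=
  contMDiff_zeroSection ℝ (TangentSpace I)

lemma IsSmoothVF.sum {ι : Type*} (t : Finset ι) {X : ι → VField I M}
    (hX : ∀ i ∈ t, IsSmoothVF I (X i)) : IsSmoothVF I (∑ i ∈ t, X i) := by
  classical
  induction t using Finset.induction_on with
  | empty => simpa using isSmoothVF_zero
  | insert i t hi ih =>
    rw [Finset.sum_insert hi]
    exact (hX i (by simp)).add (ih fun j hj => hX j (by simp [hj]))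

lemma IsSmoothVF.mdifferentiableAt {X : VField I M} (hX : IsSmoothVF I X) (p : M) :
    MDifferentiableAt I (I.prod 𝓘(ℝ, E)) (fun q => TotalSpace.mk' E q (X q)) p :=
  (hX p).mdifferentiableAt (by simp)

lemma IsSmoothOneForm.add {α β : CovField I M} (hα : IsSmoothOneForm I α)
    (hβ : IsSmoothOneForm I β) : IsSmoothOneForm I (α + β) :=
  ContMDiff.add_section hα hβ

lemma IsSmoothOneForm.smul {h : M → ℝ} {α : CovField I M} (hh : ContMDiff I 𝓘(ℝ, ℝ) ∞ h)
    (hα : IsSmoothOneForm I α) : IsSmoothOneForm I (h • α) :=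
  ContMDiff.smul_section hh hα

variable [FiniteDimensional ℝ E] [T2Space M]

/-- A smooth vector field is near every point a combination of the fields of a smooth frame. -/
lemma exists_frame_expansion (p : M) : ∃ (s : Fin (Module.finrank ℝ E) → VField I M)
    (θ : Fin (Module.finrank ℝ E) → CovField I M),
    (∀ i, IsSmoothVF I (s i)) ∧ (∀ i, IsSmoothOneForm I (θ i)) ∧
    ∀ X : VField I M, ∀ᶠ q in 𝓝 p, X q = (∑ i, (fun q => θ i q (X q)) • s i) q := by
  obtain ⟨s, θ, hs, hθ, h⟩ := exists_frame (I := I) p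
  refine ⟨s, θ, hs, hθ, fun X => ?_⟩
  filter_upwards [h] with q hq
  conv_lhs => rw [hq (X q)]
  simp

/-- Every tangent vector is the value of a smooth vector field. -/
lemma exists_smoothVF_eq (p : M) (v : TangentSpace I p) :
    ∃ X : VField I M, IsSmoothVF I X ∧ X p = v := by
  obtain ⟨s, θ, hs, hθ, h⟩ := exists_frame (I := I) p
  refine ⟨∑ i, (fun _ : M => θ i p v) • s i,
    IsSmoothVF.sum _ fun i _ => (hs i).smul contMDiff_const, ?_⟩
  conv_rhs => rw [h.self_of_nhds v]
  simp

lemma covector_ext {p : M} {α β : TangentSpace I p →L[ℝ] ℝ}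
    (h : ∀ X : VField I M, IsSmoothVF I X → α (X p) = β (X p)) : α = β := by
  ext v
  obtain ⟨X, hX, rfl⟩ := exists_smoothVF_eq p v
  exact h X hX

/-- A function of smooth vector fields that is additive and homogeneous over the smooth functions
evaluated at `p` is given by a covector at `p`. -/
lemma exists_covector {p : M} {Φ : VField I M → ℝ}
    (hadd : ∀ X Y : VField I M, IsSmoothVF I X → IsSmoothVF I Y → Φ (X + Y) = Φ X + Φ Y)
    (hsmul : ∀ (h : M → ℝ) (X : VField I M), ContMDiff I 𝓘(ℝ, ℝ) ∞ h → IsSmoothVF I X →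
      Φ (h • X) = h p * Φ X) :
    ∃ α : TangentSpace I p →L[ℝ] ℝ, ∀ Z : VField I M, IsSmoothVF I Z → α (Z p) = Φ Z := by
  -- Multiplying by a bump function that is `1` at `p` leaves `Φ` unchanged and makes fields with
  -- equal germs equal. Afterwards a frame expansion, valid only near `p`, may be inserted into `Φ`.
  have hloc : ∀ X Y : VField I M, IsSmoothVF I X → IsSmoothVF I Y →
      (∀ᶠ q in 𝓝 p, X q = Y q) →
      Φ X = Φ Y := by
    intro X Y hX hY hXY
    obtain ⟨ψ, -, hψ⟩ := (SmoothBumpFunction.nhds_basis_support (I := I)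
      (c := p) Filter.univ_mem).mem_iff.1 hXY
    have : (ψ : M → ℝ) • X = (ψ : M → ℝ) • Y := by
      ext q
      by_cases hq : q ∈ Function.support ψ
      · have : X q = Y q := hψ hq
        simp [this]
      · simp [Function.notMem_support.1 hq]
    have h₁ := hsmul ψ X ψ.contMDiff hX
    rw [this, hsmul ψ Y ψ.contMDiff hY] at h₁
    simpa using h₁.symm
  have hzero : Φ 0 = 0 := by
    simpa using hsmul (fun _ => 0) 0 contMDiff_const isSmoothVF_zero
  have hsum : ∀ (t : Finset (Fin (Module.finrank ℝ E)))
      (X : Fin (Module.finrank ℝ E) → VField I M), (∀ i, IsSmoothVF I (X i)) →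
      Φ (∑ i ∈ t, X i) = ∑ i ∈ t, Φ (X i) := by
    intro t X hX
    induction t using Finset.induction_on with
    | empty => simpa using hzero
    | insert i t hi ih =>
      rw [Finset.sum_insert hi, Finset.sum_insert hi,
        hadd _ _ (hX i) (IsSmoothVF.sum _ fun i _ => hX i), ih]
  obtain ⟨s, θ, hs, hθ, h⟩ := exists_frame_expansion (I := I) p
  refine ⟨∑ i, Φ (s i) • θ i p, fun Z hZ => ?_⟩
  have hc : ∀ i, IsSmoothVF I ((fun q => θ i q (Z q)) • s i) := fun i =>
    (hs i).smul ((hθ i).apply hZ)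
  rw [hloc Z _ hZ (IsSmoothVF.sum _ fun i _ => hc i) (h Z), hsum _ _ hc]
  simp only [sum_apply, smul_apply, smul_eq_mul]
  refine Finset.sum_congr rfl fun i _ => ?_
  rw [hsmul _ _ ((hθ i).apply hZ) (hs i), mul_comm]

/-- Tensoriality rules out the default value `0` in `toCovector`. -/
lemma toCovector_apply {p : M} {Φ : VField I M → ℝ}
    (hadd : ∀ X Y : VField I M, IsSmoothVF I X → IsSmoothVF I Y → Φ (X + Y) = Φ X + Φ Y)
    (hsmul : ∀ (h : M → ℝ) (X : VField I M), ContMDiff I 𝓘(ℝ, ℝ) ∞ h → IsSmoothVF I X →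
      Φ (h • X) = h p * Φ X) {Z : VField I M} (hZ : IsSmoothVF I Z) :
    toCovector I p Φ (Z p) = Φ Z := by
  have h := exists_covector hadd hsmul
  rw [toCovector, dif_pos h]
  exact h.choose_spec Z hZ

end Tensoriality

/-! ### Algebraic rules, smoothness and locality of the Koszul form -/

section Koszul

variable {E : Type*} [NormedAddCommGroup E] [NormedSpace ℝ E]
  {H : Type*} [TopologicalSpace H] {I : ModelWithCorners ℝ E H}
  {M : Type*} [TopologicalSpace M] [ChartedSpace H M]

lemma dirDeriv_add_field (X Y : VField I M) (h : M → ℝ) (p : M) :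
    dirDeriv I (X + Y) h p = dirDeriv I X h p + dirDeriv I Y h p := by
  simp [dirDeriv]

lemma dirDeriv_smul_field (k : M → ℝ) (X : VField I M) (h : M → ℝ) (p : M) :
    dirDeriv I (k • X) h p = k p * dirDeriv I X h p := by
  simp [dirDeriv]

lemma dirDeriv_add (X : VField I M) {h k : M → ℝ} (hh : ContMDiff I 𝓘(ℝ, ℝ) ∞ h)
    (hk : ContMDiff I 𝓘(ℝ, ℝ) ∞ k) (p : M) :
    dirDeriv I X (h + k) p = dirDeriv I X h p + dirDeriv I X k p := by
  simp [dirDeriv, mvfderiv_add ((hh p).mdifferentiableAt (by simp))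
    ((hk p).mdifferentiableAt (by simp))]

lemma dirDeriv_mul (X : VField I M) {h k : M → ℝ} (hh : ContMDiff I 𝓘(ℝ, ℝ) ∞ h)
    (hk : ContMDiff I 𝓘(ℝ, ℝ) ∞ k) (p : M) :
    dirDeriv I X (h * k) p = h p * dirDeriv I X k p + k p * dirDeriv I X h p := by
  simp [dirDeriv, mvfderiv_mul ((hh p).mdifferentiableAt (by simp))
    ((hk p).mdifferentiableAt (by simp))]

lemma dirDeriv_congr {X X' : VField I M} {h h' : M → ℝ} {p : M} (hX : X p = X' p)
    (hh : h =ᶠ[𝓝 p] h') : dirDeriv I X h p = dirDeriv I X' h' p := by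
  simp only [dirDeriv, mvfderiv, hX, hh.mfderiv_eq]
  rfl

variable [IsManifold I ∞ M]

lemma contMDiff_dirDeriv {X : VField I M} {h : M → ℝ} (hX : IsSmoothVF I X)
    (hh : ContMDiff I 𝓘(ℝ, ℝ) ∞ h) : ContMDiff I 𝓘(ℝ, ℝ) ∞ (dirDeriv I X h) :=
  (contMDiff_snd_tangentBundle_modelSpace ℝ 𝓘(ℝ, ℝ)).comp
    ((hh.contMDiff_tangentMap (m := ∞) (by simp)).comp hX)

variable [FiniteDimensional ℝ E]

lemma IsSmoothVF.mlieBracket {X Y : VField I M} (hX : IsSmoothVF I X) (hY : IsSmoothVF I Y) :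
    IsSmoothVF I (mlieBracket I X Y) :=
  -- The bracket costs one derivative, which is free at smoothness `∞` because `∞ + 1 = ∞`.
  have : IsManifold I ((⊤ : ℕ∞) + 1) M := by
    have h : (((⊤ : ℕ∞) : WithTop ℕ∞) + 1) = ∞ := rfl
    rw [h]
    infer_instance
  have : IsManifold I (minSmoothness ℝ 2) M := by
    rw [minSmoothness_of_isRCLikeNormedField]
    infer_instance
  ContDiff.mlieBracket_vectorField (m := ⊤) (n := ⊤) hX hY
    (by rw [minSmoothness_of_isRCLikeNormedField]; simp)

variable [T2Space M] {g : BilinField I M} {X Y Z X' Y' Z' : VField I M} {h : M → ℝ}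

lemma pairing_add_left : pairing I g (X + X') Y = pairing I g X Y + pairing I g X' Y := by
  ext p; simp [pairing]

lemma pairing_add_right : pairing I g X (Y + Y') = pairing I g X Y + pairing I g X Y' := by
  ext p; simp [pairing]

lemma pairing_smul_left : pairing I g (h • X) Y = h * pairing I g X Y := by
  ext p; simp [pairing]

lemma pairing_smul_right : pairing I g X (h • Y) = h * pairing I g X Y := by
  ext p; simp [pairing]

lemma IsSingularMetric.pairing_comm (hg : IsSingularMetric I g) :
    pairing I g X Y = pairing I g Y X :=
  funext fun p => hg.symm p _ _

lemma IsSingularMetric.contMDiff_pairing (hg : IsSingularMetric I g) (hX : IsSmoothVF I X)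
    (hY : IsSmoothVF I Y) : ContMDiff I 𝓘(ℝ, ℝ) ∞ (pairing I g X Y) :=
  contMDiff_bilinField_iff.1 hg.smooth X Y hX hY

lemma IsSingularMetric.koszul_add_third (hg : IsSingularMetric I g) (hX : IsSmoothVF I X)
    (hY : IsSmoothVF I Y) (hZ : IsSmoothVF I Z) (hZ' : IsSmoothVF I Z') (p : M) :
    koszul I g X Y (Z + Z') p = koszul I g X Y Z p + koszul I g X Y Z' p := by
  have h₁ : pairing I g X (VectorField.mlieBracket I Y (Z + Z')) p =
      pairing I g X (VectorField.mlieBracket I Y Z) p +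
      pairing I g X (VectorField.mlieBracket I Y Z') p := by
    simp [pairing, mlieBracket_add_right (hZ.mdifferentiableAt p) (hZ'.mdifferentiableAt p)]
  have h₂ : pairing I g Y (VectorField.mlieBracket I (Z + Z') X) p =
      pairing I g Y (VectorField.mlieBracket I Z X) p +
      pairing I g Y (VectorField.mlieBracket I Z' X) p := by
    simp [pairing, mlieBracket_add_left (hZ.mdifferentiableAt p) (hZ'.mdifferentiableAt p)]
  simp only [koszul, h₁, h₂]
  rw [pairing_add_right, pairing_add_left, pairing_add_left,
    dirDeriv_add _ (hg.contMDiff_pairing hY hZ) (hg.contMDiff_pairing hY hZ'),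
    dirDeriv_add _ (hg.contMDiff_pairing hZ hX) (hg.contMDiff_pairing hZ' hX),
    dirDeriv_add_field]
  simp only [Pi.add_apply]
  ring

/-- The derivatives of `h` cancel in pairs: `X(h)⟨Y,Z⟩` from the first term against `⟨Y,[hZ,X]⟩`,
and `Y(h)⟨Z,X⟩` from the second against `⟨X,[Y,hZ]⟩`. -/
lemma IsSingularMetric.koszul_smul_third (hg : IsSingularMetric I g) (hX : IsSmoothVF I X)
    (hY : IsSmoothVF I Y) (hZ : IsSmoothVF I Z) (hh : ContMDiff I 𝓘(ℝ, ℝ) ∞ h) (p : M) :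
    koszul I g X Y (h • Z) p = h p * koszul I g X Y Z p := by
  have hh' := (hh p).mdifferentiableAt (by simp)
  have h₁ : pairing I g X (VectorField.mlieBracket I Y (h • Z)) p =
      dirDeriv I Y h p * pairing I g X Z p +
      h p * pairing I g X (VectorField.mlieBracket I Y Z) p := by
    simp [pairing, dirDeriv, mlieBracket_smul_right hh' (hZ.mdifferentiableAt p)]
  have h₂ : pairing I g Y (VectorField.mlieBracket I (h • Z) X) p =
      - dirDeriv I X h p * pairing I g Y Z p +
      h p * pairing I g Y (VectorField.mlieBracket I Z X) p := by
    simp [pairing, dirDeriv, mlieBracket_smul_left hh' (hZ.mdifferentiableAt p)]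
  simp only [koszul, h₁, h₂]
  rw [pairing_smul_right, pairing_smul_left, pairing_smul_left,
    dirDeriv_mul _ hh (hg.contMDiff_pairing hY hZ),
    dirDeriv_mul _ hh (hg.contMDiff_pairing hZ hX), dirDeriv_smul_field,
    hg.pairing_comm (X := X) (Y := Z)]
  simp only [Pi.mul_apply]
  ring

/-- Metric compatibility: all terms but the first are antisymmetric in `Y` and `Z`. Through it the
rules for the second argument follow from those for the third. -/
lemma IsSingularMetric.koszul_add_swap (hg : IsSingularMetric I g) (p : M) :
    koszul I g X Y Z p + koszul I g X Z Y p = dirDeriv I X (pairing I g Y Z) p := by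
  have hsw : ∀ U V W : VField I M, pairing I g U (VectorField.mlieBracket I V W) p =
      - pairing I g U (VectorField.mlieBracket I W V) p := by
    intro U V W
    rw [mlieBracket_swap]
    simp [pairing]
  simp only [koszul]
  rw [hsw X Z Y, hsw Z Y X, hsw Y X Z, hg.pairing_comm (X := Z) (Y := Y),
    hg.pairing_comm (X := X) (Y := Z), hg.pairing_comm (X := Y) (Y := X)]
  ring

/-- Vanishing torsion. Through it the rules for the first argument follow from those for the second.
-/
lemma IsSingularMetric.koszul_sub_swap (hg : IsSingularMetric I g) (p : M) :
    koszul I g X Y Z p - koszul I g Y X Z p =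
      pairing I g Z (VectorField.mlieBracket I X Y) p := by
  have hsw : ∀ U V W : VField I M, pairing I g U (VectorField.mlieBracket I V W) p =
      - pairing I g U (VectorField.mlieBracket I W V) p := by
    intro U V W
    rw [mlieBracket_swap]
    simp [pairing]
  simp only [koszul]
  rw [hsw Y X Z, hsw X Z Y, hsw Z Y X, hg.pairing_comm (X := Z) (Y := X),
    hg.pairing_comm (X := Y) (Y := Z), hg.pairing_comm (X := Y) (Y := X)]
  ring

lemma IsSingularMetric.koszul_add_second (hg : IsSingularMetric I g) (hX : IsSmoothVF I X)
    (hY : IsSmoothVF I Y) (hY' : IsSmoothVF I Y') (hZ : IsSmoothVF I Z) (p : M) :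
    koszul I g X (Y + Y') Z p = koszul I g X Y Z p + koszul I g X Y' Z p := by
  have h₁ := hg.koszul_add_swap (X := X) (Y := Y + Y') (Z := Z) p
  have h₂ := hg.koszul_add_swap (X := X) (Y := Y) (Z := Z) p
  have h₃ := hg.koszul_add_swap (X := X) (Y := Y') (Z := Z) p
  rw [hg.koszul_add_third hX hZ hY hY', pairing_add_left,
    dirDeriv_add _ (hg.contMDiff_pairing hY hZ) (hg.contMDiff_pairing hY' hZ)] at h₁
  linarith

lemma IsSingularMetric.koszul_smul_second (hg : IsSingularMetric I g) (hX : IsSmoothVF I X)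
    (hY : IsSmoothVF I Y) (hZ : IsSmoothVF I Z) (hh : ContMDiff I 𝓘(ℝ, ℝ) ∞ h) (p : M) :
    koszul I g X (h • Y) Z p =
      h p * koszul I g X Y Z p + dirDeriv I X h p * pairing I g Y Z p := by
  have h₁ := hg.koszul_add_swap (X := X) (Y := h • Y) (Z := Z) p
  have h₂ := hg.koszul_add_swap (X := X) (Y := Y) (Z := Z) p
  rw [hg.koszul_smul_third hX hZ hY hh, pairing_smul_left,
    dirDeriv_mul _ hh (hg.contMDiff_pairing hY hZ), ← h₂] at h₁
  linarith

lemma IsSingularMetric.koszul_add_first (hg : IsSingularMetric I g) (hX : IsSmoothVF I X)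
    (hX' : IsSmoothVF I X') (hY : IsSmoothVF I Y) (hZ : IsSmoothVF I Z) (p : M) :
    koszul I g (X + X') Y Z p = koszul I g X Y Z p + koszul I g X' Y Z p := by
  have h₁ := hg.koszul_sub_swap (X := X + X') (Y := Y) (Z := Z) p
  have h₂ := hg.koszul_sub_swap (X := X) (Y := Y) (Z := Z) p
  have h₃ := hg.koszul_sub_swap (X := X') (Y := Y) (Z := Z) p
  have h₄ : pairing I g Z (VectorField.mlieBracket I (X + X') Y) p =
      pairing I g Z (VectorField.mlieBracket I X Y) p +
      pairing I g Z (VectorField.mlieBracket I X' Y) p := by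
    simp [pairing, mlieBracket_add_left (hX.mdifferentiableAt p) (hX'.mdifferentiableAt p)]
  rw [hg.koszul_add_second hY hX hX' hZ, h₄] at h₁
  linarith

lemma IsSingularMetric.koszul_smul_first (hg : IsSingularMetric I g) (hX : IsSmoothVF I X)
    (hY : IsSmoothVF I Y) (hZ : IsSmoothVF I Z) (hh : ContMDiff I 𝓘(ℝ, ℝ) ∞ h) (p : M) :
    koszul I g (h • X) Y Z p = h p * koszul I g X Y Z p := by
  have h₁ := hg.koszul_sub_swap (X := h • X) (Y := Y) (Z := Z) p
  have h₂ := hg.koszul_sub_swap (X := X) (Y := Y) (Z := Z) p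
  have h₄ : pairing I g Z (VectorField.mlieBracket I (h • X) Y) p =
      - dirDeriv I Y h p * pairing I g Z X p +
      h p * pairing I g Z (VectorField.mlieBracket I X Y) p := by
    simp [pairing, dirDeriv, mlieBracket_smul_left ((hh p).mdifferentiableAt (by simp))
      (hX.mdifferentiableAt p)]
  rw [hg.koszul_smul_second hY hX hZ hh, h₄, ← h₂, hg.pairing_comm (X := Z)] at h₁
  linarith

lemma IsSingularMetric.contMDiff_koszul (hg : IsSingularMetric I g) (hX : IsSmoothVF I X)
    (hY : IsSmoothVF I Y) (hZ : IsSmoothVF I Z) :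
    ContMDiff I 𝓘(ℝ, ℝ) ∞ (koszul I g X Y Z) := by
  have h₁ := contMDiff_dirDeriv hX (hg.contMDiff_pairing hY hZ)
  have h₂ := contMDiff_dirDeriv hY (hg.contMDiff_pairing hZ hX)
  have h₃ := contMDiff_dirDeriv hZ (hg.contMDiff_pairing hX hY)
  have h₄ := hg.contMDiff_pairing hX (hY.mlieBracket hZ)
  have h₅ := hg.contMDiff_pairing hY (hZ.mlieBracket hX)
  have h₆ := hg.contMDiff_pairing hZ (hX.mlieBracket hY)
  exact contMDiff_const.mul (((((h₁.add h₂).sub h₃).sub h₄).add h₅).add h₆)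

/-- The Koszul form depends only on the germs of the vector fields. -/
lemma koszul_congr {p : M} (hX : ∀ᶠ q in 𝓝 p, X q = X' q) (hY : ∀ᶠ q in 𝓝 p, Y q = Y' q)
    (hZ : ∀ᶠ q in 𝓝 p, Z q = Z' q) : koszul I g X Y Z p = koszul I g X' Y' Z' p := by
  have hp : ∀ {U U' V V' : VField I M}, (∀ᶠ q in 𝓝 p, U q = U' q) → (∀ᶠ q in 𝓝 p, V q = V' q) →
      pairing I g U V =ᶠ[𝓝 p] pairing I g U' V' := by
    intro U U' V V' hU hV
    filter_upwards [hU, hV] with q h₁ h₂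
    simp [pairing, h₁, h₂]
  have hl : ∀ {U U' V V' : VField I M}, (∀ᶠ q in 𝓝 p, U q = U' q) → (∀ᶠ q in 𝓝 p, V q = V' q) →
      VectorField.mlieBracket I U V p = VectorField.mlieBracket I U' V' p := fun hU hV =>
    Filter.EventuallyEq.mlieBracket_vectorField_eq hU hV
  simp only [koszul, dirDeriv_congr hX.self_of_nhds (hp hY hZ),
    dirDeriv_congr hY.self_of_nhds (hp hZ hX), dirDeriv_congr hZ.self_of_nhds (hp hX hY)]
  simp only [pairing, hX.self_of_nhds, hY.self_of_nhds, hZ.self_of_nhds, hl hX hY, hl hY hZ,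
    hl hZ hX]

end Koszul

/-! ### The almost product Koszul form, raised covectors and `∇̃` of `1`-forms -/

section AlmostProduct

variable {E : Type*} [NormedAddCommGroup E] [NormedSpace ℝ E] [FiniteDimensional ℝ E]
  {H : Type*} [TopologicalSpace H] {I : ModelWithCorners ℝ E H}
  {M : Type*} [TopologicalSpace M] [ChartedSpace H M] [IsManifold I ∞ M] [T2Space M]
  {g : BilinField I M} {J : EndField I M} {X Y Z X' Y' Z' : VField I M} {h : M → ℝ}

lemma endField_add : (fun q => J q ((X + Y) q)) =
    (fun q => J q (X q) : VField I M) + fun q => J q (Y q) := by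
  ext q; simp

lemma endField_smul : (fun q => J q ((h • X) q)) = h • (fun q => J q (X q) : VField I M) := by
  ext q; simp

lemma IsAlmostProduct.smoothVF (hJ : IsAlmostProduct I g J) (hX : IsSmoothVF I X) :
    IsSmoothVF I (fun q => J q (X q)) :=
  contMDiff_endField_iff.1 hJ.smooth X hX

lemma IsAlmostProduct.pairing_endField (hJ : IsAlmostProduct I g J) :
    pairing I g (fun q => J q (X q)) (fun q => J q (Y q)) = pairing I g X Y :=
  funext fun q => hJ.isometric q _ _

lemma IsAlmostProduct.apKoszul_add_third (hJ : IsAlmostProduct I g J) (hX : IsSmoothVF I X)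
    (hY : IsSmoothVF I Y) (hZ : IsSmoothVF I Z) (hZ' : IsSmoothVF I Z') (p : M) :
    apKoszul I g J X Y (Z + Z') p = apKoszul I g J X Y Z p + apKoszul I g J X Y Z' p := by
  simp only [apKoszul]
  rw [endField_add, hJ.metric.koszul_add_third hX hY hZ hZ', hJ.metric.koszul_add_third hX
    (hJ.smoothVF hY) (hJ.smoothVF hZ) (hJ.smoothVF hZ')]
  ring

lemma IsAlmostProduct.apKoszul_smul_third (hJ : IsAlmostProduct I g J) (hX : IsSmoothVF I X)
    (hY : IsSmoothVF I Y) (hZ : IsSmoothVF I Z) (hh : ContMDiff I 𝓘(ℝ, ℝ) ∞ h) (p : M) :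
    apKoszul I g J X Y (h • Z) p = h p * apKoszul I g J X Y Z p := by
  simp only [apKoszul]
  rw [endField_smul, hJ.metric.koszul_smul_third hX hY hZ hh, hJ.metric.koszul_smul_third hX
    (hJ.smoothVF hY) (hJ.smoothVF hZ) hh]
  ring

lemma IsAlmostProduct.apKoszul_add_second (hJ : IsAlmostProduct I g J) (hX : IsSmoothVF I X)
    (hY : IsSmoothVF I Y) (hY' : IsSmoothVF I Y') (hZ : IsSmoothVF I Z) (p : M) :
    apKoszul I g J X (Y + Y') Z p = apKoszul I g J X Y Z p + apKoszul I g J X Y' Z p := by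
  simp only [apKoszul]
  rw [endField_add, hJ.metric.koszul_add_second hX hY hY' hZ, hJ.metric.koszul_add_second hX
    (hJ.smoothVF hY) (hJ.smoothVF hY') (hJ.smoothVF hZ)]
  ring

lemma IsAlmostProduct.apKoszul_smul_second (hJ : IsAlmostProduct I g J) (hX : IsSmoothVF I X)
    (hY : IsSmoothVF I Y) (hZ : IsSmoothVF I Z) (hh : ContMDiff I 𝓘(ℝ, ℝ) ∞ h) (p : M) :
    apKoszul I g J X (h • Y) Z p =
      h p * apKoszul I g J X Y Z p + dirDeriv I X h p * pairing I g Y Z p := by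
  simp only [apKoszul]
  rw [endField_smul, hJ.metric.koszul_smul_second hX hY hZ hh, hJ.metric.koszul_smul_second hX
    (hJ.smoothVF hY) (hJ.smoothVF hZ) hh, hJ.pairing_endField]
  ring

lemma IsAlmostProduct.apKoszul_add_first (hJ : IsAlmostProduct I g J) (hX : IsSmoothVF I X)
    (hX' : IsSmoothVF I X') (hY : IsSmoothVF I Y) (hZ : IsSmoothVF I Z) (p : M) :
    apKoszul I g J (X + X') Y Z p = apKoszul I g J X Y Z p + apKoszul I g J X' Y Z p := by
  simp only [apKoszul]
  rw [hJ.metric.koszul_add_first hX hX' hY hZ, hJ.metric.koszul_add_first hX hX'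
    (hJ.smoothVF hY) (hJ.smoothVF hZ)]
  ring

lemma IsAlmostProduct.apKoszul_smul_first (hJ : IsAlmostProduct I g J) (hX : IsSmoothVF I X)
    (hY : IsSmoothVF I Y) (hZ : IsSmoothVF I Z) (hh : ContMDiff I 𝓘(ℝ, ℝ) ∞ h) (p : M) :
    apKoszul I g J (h • X) Y Z p = h p * apKoszul I g J X Y Z p := by
  simp only [apKoszul]
  rw [hJ.metric.koszul_smul_first hX hY hZ hh, hJ.metric.koszul_smul_first hX
    (hJ.smoothVF hY) (hJ.smoothVF hZ) hh]
  ring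

/-- Compatibility of the almost product Koszul form with the metric. -/
lemma IsAlmostProduct.apKoszul_add_swap (hJ : IsAlmostProduct I g J) (p : M) :
    apKoszul I g J X Y Z p + apKoszul I g J X Z Y p = dirDeriv I X (pairing I g Y Z) p := by
  have h₁ := hJ.metric.koszul_add_swap (X := X) (Y := Y) (Z := Z) p
  have h₂ := hJ.metric.koszul_add_swap (X := X) (Y := fun q => J q (Y q))
    (Z := fun q => J q (Z q)) p
  rw [hJ.pairing_endField] at h₂
  simp only [apKoszul]
  linarith

lemma IsAlmostProduct.contMDiff_apKoszul (hJ : IsAlmostProduct I g J) (hX : IsSmoothVF I X)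
    (hY : IsSmoothVF I Y) (hZ : IsSmoothVF I Z) :
    ContMDiff I 𝓘(ℝ, ℝ) ∞ (apKoszul I g J X Y Z) :=
  contMDiff_const.mul ((hJ.metric.contMDiff_koszul hX hY hZ).add
    (hJ.metric.contMDiff_koszul hX (hJ.smoothVF hY) (hJ.smoothVF hZ)))

lemma apKoszul_congr {p : M} (hX : ∀ᶠ q in 𝓝 p, X q = X' q) (hY : ∀ᶠ q in 𝓝 p, Y q = Y' q)
    (hZ : ∀ᶠ q in 𝓝 p, Z q = Z' q) : apKoszul I g J X Y Z p = apKoszul I g J X' Y' Z' p := by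
  simp only [apKoszul, koszul_congr hX hY hZ, koszul_congr hX
    (hY.mono fun q hq => congrArg (J q) hq) (hZ.mono fun q hq => congrArg (J q) hq)]

lemma IsAlmostProduct.apLowerDeriv_apply (hJ : IsAlmostProduct I g J) (hX : IsSmoothVF I X)
    (hY : IsSmoothVF I Y) (hZ : IsSmoothVF I Z) (p : M) :
    apLowerDeriv I g J X Y p (Z p) = apKoszul I g J X Y Z p :=
  toCovector_apply (Φ := fun Z => apKoszul I g J X Y Z p)
    (fun _ _ hZ hZ' => hJ.apKoszul_add_third hX hY hZ hZ' p)
    (fun _ _ hh hZ => hJ.apKoszul_smul_third hX hY hZ hh p) hZ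

lemma IsAlmostProduct.isSmoothOneForm_apLowerDeriv (hJ : IsAlmostProduct I g J)
    (hX : IsSmoothVF I X) (hY : IsSmoothVF I Y) :
    IsSmoothOneForm I (apLowerDeriv I g J X Y) :=
  isSmoothOneForm_iff.2 fun _ hZ =>
    (hJ.contMDiff_apKoszul hX hY hZ).congr fun p => hJ.apLowerDeriv_apply hX hY hZ p

lemma IsAlmostProduct.apLowerDeriv_add_first (hJ : IsAlmostProduct I g J) (hX : IsSmoothVF I X)
    (hX' : IsSmoothVF I X') (hY : IsSmoothVF I Y) :
    apLowerDeriv I g J (X + X') Y = apLowerDeriv I g J X Y + apLowerDeriv I g J X' Y := by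
  ext1 p
  refine covector_ext fun Z hZ => ?_
  simp [hJ.apLowerDeriv_apply, hX, hX', hX.add hX', hY, hZ, hJ.apKoszul_add_first]

lemma IsAlmostProduct.apLowerDeriv_smul_first (hJ : IsAlmostProduct I g J) (hX : IsSmoothVF I X)
    (hY : IsSmoothVF I Y) (hh : ContMDiff I 𝓘(ℝ, ℝ) ∞ h) :
    apLowerDeriv I g J (h • X) Y = h • apLowerDeriv I g J X Y := by
  ext1 p
  refine covector_ext fun Z hZ => ?_
  simp [hJ.apLowerDeriv_apply, hX, hX.smul hh, hY, hZ, hJ.apKoszul_smul_first, hh]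

lemma IsAlmostProduct.apLowerDeriv_add_second (hJ : IsAlmostProduct I g J) (hX : IsSmoothVF I X)
    (hY : IsSmoothVF I Y) (hY' : IsSmoothVF I Y') :
    apLowerDeriv I g J X (Y + Y') = apLowerDeriv I g J X Y + apLowerDeriv I g J X Y' := by
  ext1 p
  refine covector_ext fun Z hZ => ?_
  simp [hJ.apLowerDeriv_apply, hX, hY', hY.add hY', hY, hZ, hJ.apKoszul_add_second]

/-- The `1`-form `g(Y, ·)`. -/
def lowering (g : BilinField I M) (Y : VField I M) : CovField I M := fun p => g p (Y p)

lemma IsSingularMetric.isSmoothOneForm_lowering (hg : IsSingularMetric I g)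
    (hY : IsSmoothVF I Y) : IsSmoothOneForm I (lowering g Y) :=
  isSmoothOneForm_iff.2 fun _ hZ => hg.contMDiff_pairing hY hZ

lemma IsAlmostProduct.apLowerDeriv_smul_second (hJ : IsAlmostProduct I g J)
    (hX : IsSmoothVF I X) (hY : IsSmoothVF I Y) (hh : ContMDiff I 𝓘(ℝ, ℝ) ∞ h) :
    apLowerDeriv I g J X (h • Y) = h • apLowerDeriv I g J X Y + dirDeriv I X h • lowering g Y := by
  ext1 p
  refine covector_ext fun Z hZ => ?_
  simp [hJ.apLowerDeriv_apply, hX, hY.smul hh, hY, hZ, hJ.apKoszul_smul_second, hh, lowering,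
    pairing]

lemma IsAlmostProduct.apLowerDeriv_congr (hJ : IsAlmostProduct I g J) {p : M}
    (hX : IsSmoothVF I X) (hX' : IsSmoothVF I X') (hY : IsSmoothVF I Y) (hY' : IsSmoothVF I Y')
    (hXX' : ∀ᶠ q in 𝓝 p, X q = X' q) (hYY' : ∀ᶠ q in 𝓝 p, Y q = Y' q) :
    apLowerDeriv I g J X Y p = apLowerDeriv I g J X' Y' p := by
  refine covector_ext fun Z hZ => ?_
  rw [hJ.apLowerDeriv_apply hX hY hZ, hJ.apLowerDeriv_apply hX' hY' hZ,
    apKoszul_congr hXX' hYY' (Filter.Eventually.of_forall fun _ => rfl)]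

/-- The inner product `⟪α, τ⟫_•` for `α = g(v, ·)` and `τ = g(w, ·)`. -/
lemma IsSingularMetric.coInner_eq (hg : IsSingularMetric I g) {p : M}
    {α τ : TangentSpace I p →L[ℝ] ℝ} {v w : TangentSpace I p} (hα : α = g p v)
    (hτ : τ = g p w) : coInner I g p α τ = g p v w := by
  have h : (∃ v : TangentSpace I p, α = g p v) ∧ (∃ w : TangentSpace I p, τ = g p w) :=
    ⟨⟨v, hα⟩, w, hτ⟩
  rw [coInner, dif_pos h]
  calc g p h.1.choose h.2.choose
      = α h.2.choose := (DFunLike.congr_fun h.1.choose_spec _).symm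
    _ = g p v h.2.choose := DFunLike.congr_fun hα _
    _ = g p h.2.choose v := hg.symm _ _ _
    _ = τ v := (DFunLike.congr_fun h.2.choose_spec _).symm
    _ = g p w v := DFunLike.congr_fun hτ _
    _ = g p v w := hg.symm _ _ _

/-- Pairing with `g(v, ·)` is evaluation at `v`. The other covector must be known to lie in the
image of `g` as well, since otherwise `coInner` takes its default value `0`. -/
lemma IsSingularMetric.coInner_eq_apply_right (hg : IsSingularMetric I g) {p : M}
    {α τ : TangentSpace I p →L[ℝ] ℝ} {v : TangentSpace I p} (hα : α = g p v)
    (hτ : ∃ w, τ = g p w) : coInner I g p α τ = τ v := by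
  obtain ⟨w, rfl⟩ := hτ
  rw [hg.coInner_eq hα rfl, hg.symm]

lemma IsSingularMetric.coInner_eq_apply_left (hg : IsSingularMetric I g) {p : M}
    {α τ : TangentSpace I p →L[ℝ] ℝ} {w : TangentSpace I p} (hα : ∃ v, α = g p v)
    (hτ : τ = g p w) : coInner I g p α τ = α w := by
  obtain ⟨v, rfl⟩ := hα
  rw [hg.coInner_eq rfl hτ]

lemma IsSingularMetric.coInner_comm (hg : IsSingularMetric I g) {p : M}
    {α τ : TangentSpace I p →L[ℝ] ℝ} (hα : ∃ v, α = g p v) (hτ : ∃ v, τ = g p v) :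
    coInner I g p α τ = coInner I g p τ α := by
  obtain ⟨v, rfl⟩ := hα
  obtain ⟨w, rfl⟩ := hτ
  rw [hg.coInner_eq rfl rfl, hg.coInner_eq rfl rfl, hg.symm]

lemma lowered_add {p : M} {α τ : TangentSpace I p →L[ℝ] ℝ} (hα : ∃ v, α = g p v)
    (hτ : ∃ v, τ = g p v) : ∃ v, α + τ = g p v := by
  obtain ⟨v, rfl⟩ := hα
  obtain ⟨w, rfl⟩ := hτ
  exact ⟨v + w, by simp⟩

lemma lowered_smul {p : M} {α : TangentSpace I p →L[ℝ] ℝ} (c : ℝ) (hα : ∃ v, α = g p v) :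
    ∃ v, c • α = g p v := by
  obtain ⟨v, rfl⟩ := hα
  exact ⟨c • v, by simp⟩

/-- The derivative `∇̃_Z σ` extends near `p` from the regions of constant signature to a smooth
`1`-form with values in the image of the metric. -/
def CovDerivExtendsAt (g : BilinField I M) (J : EndField I M) (Z : VField I M) (σ : CovField I M)
    (p : M) : Prop :=
  ∃ η : CovField I M, IsSmoothOneForm I η ∧ ∀ᶠ q in 𝓝 p, (∃ v, η q = g q v) ∧
    (q ∈ constSignature I g → ∀ T : VField I M, IsSmoothVF I T →
      η q (T q) = apCovDeriv I g J Z σ T q)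

/-- The vector `v` raising `∇̃♭_Z T` does not depend on `σ`, so `∇̃_Z σ` is manifestly linear in
`σ`. The calculus of `∇̃` below rests on this form. -/
lemma IsAlmostProduct.apCovDeriv_eq (hJ : IsAlmostProduct I g J) {σ : CovField I M}
    {T : VField I M} {q : M} {v : TangentSpace I q} (hv : apLowerDeriv I g J Z T q = g q v)
    (hσ : ∃ w, σ q = g q w) :
    apCovDeriv I g J Z σ T q = dirDeriv I Z (fun q => σ q (T q)) q - σ q v := by
  rw [apCovDeriv, hJ.metric.coInner_eq_apply_right hv hσ]

/-- `(∇̃_Z σ)(T)` at `q` depends only on the value of `T` at `q`. -/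
lemma IsAlmostProduct.apCovDeriv_congr_field (hJ : IsAlmostProduct I g J)
    (hlow : ∀ X Y : VField I M, IsSmoothVF I X → IsSmoothVF I Y → ∀ q,
      ∃ v, apLowerDeriv I g J X Y q = g q v) (hZ : IsSmoothVF I Z) {σ : CovField I M}
    (hσ : IsSmoothOneForm I σ) (hσ' : ∀ q, ∃ v, σ q = g q v) {T T' : VField I M}
    (hT : IsSmoothVF I T) (hT' : IsSmoothVF I T') {q : M} (hq : T q = T' q) :
    apCovDeriv I g J Z σ T q = apCovDeriv I g J Z σ T' q := by
  have key : ∃ α : TangentSpace I q →L[ℝ] ℝ, ∀ T : VField I M, IsSmoothVF I T →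
      α (T q) = apCovDeriv I g J Z σ T q := by
    refine exists_covector ?_ ?_
    · intro T T' hT hT'
      obtain ⟨v, hv⟩ := hlow Z T hZ hT q
      obtain ⟨v', hv'⟩ := hlow Z T' hZ hT' q
      have hvv' : apLowerDeriv I g J Z (T + T') q = g q (v + v') := by
        rw [hJ.apLowerDeriv_add_second hZ hT hT', Pi.add_apply, hv, hv', map_add]
      have hd := dirDeriv_add Z (hσ.apply hT) (hσ.apply hT') q
      rw [hJ.apCovDeriv_eq hv (hσ' q), hJ.apCovDeriv_eq hv' (hσ' q), hJ.apCovDeriv_eq hvv' (hσ' q),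
        map_add]
      have : (fun q => σ q ((T + T') q)) = (fun q => σ q (T q)) + fun q => σ q (T' q) := by
        ext q; simp
      rw [this, hd]
      ring
    · intro h T hh hT
      obtain ⟨v, hv⟩ := hlow Z T hZ hT q
      -- The summand `Z(h) T` of the raised vector cancels the term `Z(h) σ(T)` from the product
      -- rule.
      have hv' : apLowerDeriv I g J Z (h • T) q = g q (h q • v + dirDeriv I Z h q • T q) := by
        rw [hJ.apLowerDeriv_smul_second hZ hT hh]
        simp [hv, lowering]
      have hd := dirDeriv_mul Z hh (hσ.apply hT) q
      rw [hJ.apCovDeriv_eq hv (hσ' q), hJ.apCovDeriv_eq hv' (hσ' q)]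
      have : (fun q => σ q ((h • T) q)) = h * fun q => σ q (T q) := by
        ext q; simp
      rw [this, hd]
      simp
      ring
  obtain ⟨α, hα⟩ := key
  rw [← hα T hT, ← hα T' hT', hq]

variable {p : M} {σ σ' : CovField I M}

lemma IsAlmostProduct.covDerivExtendsAt_add (hJ : IsAlmostProduct I g J)
    (hlow : ∀ X Y : VField I M, IsSmoothVF I X → IsSmoothVF I Y → ∀ q,
      ∃ v, apLowerDeriv I g J X Y q = g q v) (hZ : IsSmoothVF I Z)
    (hσ : IsLowered I g σ) (hσ' : IsLowered I g σ') (h₁ : CovDerivExtendsAt g J Z σ p)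
    (h₂ : CovDerivExtendsAt g J Z σ' p) : CovDerivExtendsAt g J Z (σ + σ') p := by
  obtain ⟨η, hη, h₁⟩ := h₁
  obtain ⟨η', hη', h₂⟩ := h₂
  refine ⟨η + η', hη.add hη', ?_⟩
  filter_upwards [h₁, h₂] with q hq hq'
  refine ⟨lowered_add hq.1 hq'.1, fun hqs T hT => ?_⟩
  obtain ⟨v, hv⟩ := hlow Z T hZ hT q
  have hd := dirDeriv_add Z (hσ.1.apply hT) (hσ'.1.apply hT) q
  rw [Pi.add_apply, _root_.add_apply, hq.2 hqs T hT, hq'.2 hqs T hT,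
    hJ.apCovDeriv_eq hv (hσ.2 q),
    hJ.apCovDeriv_eq hv (hσ'.2 q), hJ.apCovDeriv_eq hv (lowered_add (hσ.2 q) (hσ'.2 q))]
  have : (fun q => (σ + σ') q (T q)) = (fun q => σ q (T q)) + fun q => σ' q (T q) := by
    ext q; simp
  rw [this, hd]
  simp
  ring

/-- Leibniz rule `∇̃_Z(hσ) = h ∇̃_Z σ + Z(h) σ`. The second term stays in the image of the metric
because `σ` itself does. -/
lemma IsAlmostProduct.covDerivExtendsAt_smul (hJ : IsAlmostProduct I g J)
    (hlow : ∀ X Y : VField I M, IsSmoothVF I X → IsSmoothVF I Y → ∀ q,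
      ∃ v, apLowerDeriv I g J X Y q = g q v) (hZ : IsSmoothVF I Z)
    (hσ : IsLowered I g σ) (hh : ContMDiff I 𝓘(ℝ, ℝ) ∞ h) (h₁ : CovDerivExtendsAt g J Z σ p) :
    CovDerivExtendsAt g J Z (h • σ) p := by
  obtain ⟨η, hη, h₁⟩ := h₁
  refine ⟨h • η + dirDeriv I Z h • σ, (hη.smul hh).add (hσ.1.smul (contMDiff_dirDeriv hZ hh)), ?_⟩
  filter_upwards [h₁] with q hq
  refine ⟨lowered_add (lowered_smul _ hq.1) (lowered_smul _ (hσ.2 q)), fun hqs T hT => ?_⟩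
  obtain ⟨v, hv⟩ := hlow Z T hZ hT q
  have hd := dirDeriv_mul Z hh (hσ.1.apply hT) q
  have hη := hq.2 hqs T hT
  rw [hJ.apCovDeriv_eq hv (hσ.2 q)] at hη
  rw [hJ.apCovDeriv_eq hv (lowered_smul _ (hσ.2 q))]
  have : (fun q => (h • σ) q (T q)) = h * fun q => σ q (T q) := by
    ext q; simp
  rw [this, hd]
  simp [hη]
  ring

lemma IsAlmostProduct.covDerivExtendsAt_congr (hσσ' : ∀ᶠ q in 𝓝 p, σ q = σ' q)
    (h₁ : CovDerivExtendsAt g J Z σ p) : CovDerivExtendsAt g J Z σ' p := by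
  obtain ⟨η, hη, h₁⟩ := h₁
  refine ⟨η, hη, ?_⟩
  filter_upwards [h₁, hσσ'.eventually_nhds] with q hq hq'
  refine ⟨hq.1, fun hqs T hT => ?_⟩
  rw [hq.2 hqs T hT, apCovDeriv, apCovDeriv, hq'.self_of_nhds]
  congr 1
  exact dirDeriv_congr rfl (hq'.mono fun r hr => by simp [hr])

lemma IsAlmostProduct.covDerivExtendsAt_add_field (hJ : IsAlmostProduct I g J)
    (hlow : ∀ X Y : VField I M, IsSmoothVF I X → IsSmoothVF I Y → ∀ q,
      ∃ v, apLowerDeriv I g J X Y q = g q v) (hZ : IsSmoothVF I Z) (hZ' : IsSmoothVF I Z')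
    (hσ : IsLowered I g σ) (h₁ : CovDerivExtendsAt g J Z σ p)
    (h₂ : CovDerivExtendsAt g J Z' σ p) : CovDerivExtendsAt g J (Z + Z') σ p := by
  obtain ⟨η, hη, h₁⟩ := h₁
  obtain ⟨η', hη', h₂⟩ := h₂
  refine ⟨η + η', hη.add hη', ?_⟩
  filter_upwards [h₁, h₂] with q hq hq'
  refine ⟨lowered_add hq.1 hq'.1, fun hqs T hT => ?_⟩
  obtain ⟨v, hv⟩ := hlow Z T hZ hT q
  obtain ⟨v', hv'⟩ := hlow Z' T hZ' hT q
  have hvv' : apLowerDeriv I g J (Z + Z') T q = g q (v + v') := by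
    rw [hJ.apLowerDeriv_add_first hZ hZ' hT, Pi.add_apply, hv, hv', map_add]
  rw [Pi.add_apply, _root_.add_apply, hq.2 hqs T hT, hq'.2 hqs T hT,
    hJ.apCovDeriv_eq hv (hσ.2 q), hJ.apCovDeriv_eq hv' (hσ.2 q), hJ.apCovDeriv_eq hvv' (hσ.2 q),
    dirDeriv_add_field, map_add]
  ring

lemma IsAlmostProduct.covDerivExtendsAt_smul_field (hJ : IsAlmostProduct I g J)
    (hlow : ∀ X Y : VField I M, IsSmoothVF I X → IsSmoothVF I Y → ∀ q,
      ∃ v, apLowerDeriv I g J X Y q = g q v) (hZ : IsSmoothVF I Z)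
    (hσ : IsLowered I g σ) (hh : ContMDiff I 𝓘(ℝ, ℝ) ∞ h) (h₁ : CovDerivExtendsAt g J Z σ p) :
    CovDerivExtendsAt g J (h • Z) σ p := by
  obtain ⟨η, hη, h₁⟩ := h₁
  refine ⟨h • η, hη.smul hh, ?_⟩
  filter_upwards [h₁] with q hq
  refine ⟨lowered_smul _ hq.1, fun hqs T hT => ?_⟩
  obtain ⟨v, hv⟩ := hlow Z T hZ hT q
  have hv' : apLowerDeriv I g J (h • Z) T q = g q (h q • v) := by
    rw [hJ.apLowerDeriv_smul_first hZ hT hh, Pi.smul_apply', hv, map_smul]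
  rw [Pi.smul_apply', _root_.smul_apply, hq.2 hqs T hT,
    hJ.apCovDeriv_eq hv (hσ.2 q), hJ.apCovDeriv_eq hv' (hσ.2 q), dirDeriv_smul_field]
  simp
  ring

lemma IsAlmostProduct.covDerivExtendsAt_congr_field (hJ : IsAlmostProduct I g J)
    (hZ : IsSmoothVF I Z) (hZ' : IsSmoothVF I Z')
    (hZZ' : ∀ᶠ q in 𝓝 p, Z q = Z' q) (h₁ : CovDerivExtendsAt g J Z σ p) :
    CovDerivExtendsAt g J Z' σ p := by
  obtain ⟨η, hη, h₁⟩ := h₁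
  refine ⟨η, hη, ?_⟩
  filter_upwards [h₁, hZZ'.eventually_nhds] with q hq hq'
  refine ⟨hq.1, fun hqs T hT => ?_⟩
  rw [hq.2 hqs T hT, apCovDeriv, apCovDeriv,
    hJ.apLowerDeriv_congr hZ hZ' hT hT hq' (Filter.Eventually.of_forall fun _ => rfl),
    dirDeriv_congr hq'.self_of_nhds Filter.EventuallyEq.rfl]

/-- `∇̃_Z Y♭ = ∇̃♭_Z Y`. -/
lemma IsAlmostProduct.covDerivExtendsAt_lowering (hJ : IsAlmostProduct I g J)
    (hlow : ∀ X Y : VField I M, IsSmoothVF I X → IsSmoothVF I Y → ∀ q,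
      ∃ v, apLowerDeriv I g J X Y q = g q v) (hZ : IsSmoothVF I Z) (hY : IsSmoothVF I Y) (p : M) :
    CovDerivExtendsAt g J Z (lowering g Y) p := by
  refine ⟨apLowerDeriv I g J Z Y, hJ.isSmoothOneForm_apLowerDeriv hZ hY,
    Filter.Eventually.of_forall fun q => ⟨hlow Z Y hZ hY q, fun _ T hT => ?_⟩⟩
  -- The inner product with `Y♭` is `K̃(Z,T,Y)`, so the claim is the compatibility `K̃(Z,Y,T) +
  -- K̃(Z,T,Y) = Z⟨Y,T⟩`. It holds at every point, whatever the signature.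
  rw [apCovDeriv, hJ.metric.coInner_eq_apply_left (τ := lowering g Y q)
    (w := Y q) (hlow Z T hZ hT q) rfl,
    hJ.apLowerDeriv_apply hZ hY hT, hJ.apLowerDeriv_apply hZ hT hY, eq_sub_iff_add_eq,
    hJ.apKoszul_add_swap]
  rfl

/-- Local extensions of `∇̃_Z σ` can be glued. -/
lemma extendsToLowered_of_covDerivExtendsAt [SigmaCompactSpace M]
    (h : ∀ p, CovDerivExtendsAt g J Z σ p) :
    ExtendsToLowered I g (apCovDeriv I g J Z σ) := by
  let t : ∀ q : M, Set (TangentSpace I q →L[ℝ] ℝ) := fun q =>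
    {η | (∃ v, η = g q v) ∧ (q ∈ constSignature I g → ∀ T : VField I M,
      IsSmoothVF I T → η (T q) = apCovDeriv I g J Z σ T q)}
  -- The image of `g q` is a linear subspace and the prescribed values are affine conditions, so a
  -- partition of unity can average the local extensions.
  have hconv : ∀ q, Convex ℝ (t q) := by
    intro q η hη η' hη' a b _ _ hab
    refine ⟨lowered_add (lowered_smul a hη.1) (lowered_smul b hη'.1), fun hq T hT => ?_⟩
    simp [hη.2 hq T hT, hη'.2 hq T hT, ← add_mul, hab]
  obtain ⟨s, hs⟩ := exists_contMDiffSection_forall_mem_convex_of_local (n := ⊤) I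
    (fun q : M => (TangentSpace I q →L[ℝ] ℝ)) (F_fiber := E →L[ℝ] ℝ) t hconv
    fun p => let ⟨η, hη, h⟩ := h p
      ⟨_, h, η, ContMDiff.contMDiffOn hη, fun q hq => hq⟩
  exact ⟨s, ⟨s.contMDiff, fun q => (hs q).1⟩, fun T hT q hq => (hs q).2 hq T hT⟩

end AlmostProduct

/-! ### The Lie bracket of lifted fields on a product -/

section ProductBracket

variable {E : Type*} [NormedAddCommGroup E] [NormedSpace ℝ E]
  {H : Type*} [TopologicalSpace H] {I : ModelWithCorners ℝ E H}
  {E' : Type*} [NormedAddCommGroup E'] [NormedSpace ℝ E']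
  {H' : Type*} [TopologicalSpace H'] {I' : ModelWithCorners ℝ E' H'}
  {B : Type*} [TopologicalSpace B] [ChartedSpace H B]
  {F : Type*} [TopologicalSpace F] [ChartedSpace H' F]

/-- The vector field `(V, W)` on `B × F`. -/
def prodLift (V : VField I B) (W : VField I' F) : VField (I.prod I') (B × F) := fun p =>
  ((V p.1, W p.2) : TangentSpace I p.1 × TangentSpace I' p.2)

lemma inverse_prodMap {V W V' W' : Type*} [NormedAddCommGroup V] [NormedSpace ℝ V]
    [NormedAddCommGroup W] [NormedSpace ℝ W] [NormedAddCommGroup V'] [NormedSpace ℝ V']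
    [NormedAddCommGroup W'] [NormedSpace ℝ W'] {A : V →L[ℝ] W} {A' : V' →L[ℝ] W'}
    (hA : A.IsInvertible) (hA' : A'.IsInvertible) :
    (A.prodMap A').inverse = A.inverse.prodMap A'.inverse := by
  refine ContinuousLinearMap.inverse_eq ?_ ?_
  · ext x <;> simp [hA.self_apply_inverse, hA'.self_apply_inverse]
  · ext x <;> simp [hA.inverse_apply_self, hA'.inverse_apply_self]

lemma lieBracketWithin_prodMap {V₁ V₂ : E → E} {W₁ W₂ : E' → E'} {s : Set E} {t : Set E'}
    {x : E} {y : E'} (hV₁ : DifferentiableWithinAt ℝ V₁ s x)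
    (hV₂ : DifferentiableWithinAt ℝ V₂ s x) (hW₁ : DifferentiableWithinAt ℝ W₁ t y)
    (hW₂ : DifferentiableWithinAt ℝ W₂ t y) (hs : UniqueDiffWithinAt ℝ s x)
    (ht : UniqueDiffWithinAt ℝ t y) :
    lieBracketWithin ℝ (Prod.map V₁ W₁) (Prod.map V₂ W₂) (s ×ˢ t) (x, y) =
      (lieBracketWithin ℝ V₁ V₂ s x, lieBracketWithin ℝ W₁ W₂ t y) := by
  have key : ∀ {V : E → E} {W : E' → E'}, DifferentiableWithinAt ℝ V s x →
      DifferentiableWithinAt ℝ W t y → fderivWithin ℝ (Prod.map V W) (s ×ˢ t) (x, y) =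
        (fderivWithin ℝ V s x).prodMap (fderivWithin ℝ W t y) := by
    intro V W hV hW
    exact HasFDerivWithinAt.fderivWithin (HasFDerivWithinAt.prodMap (x, y)
      (hV.hasFDerivWithinAt.mono (Set.fst_image_prod_subset s t))
      (hW.hasFDerivWithinAt.mono (Set.snd_image_prod_subset s t))) (hs.prod ht)
  simp [lieBracketWithin, key hV₁ hW₁, key hV₂ hW₂]

lemma mfderivWithin_extChartAt_prod_symm [IsManifold I 1 B] [IsManifold I' 1 F] (p : B × F)
    {y : E × E'} (hy : y ∈ (extChartAt (I.prod I') p).target) :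
    mfderivWithin 𝓘(ℝ, E × E') (I.prod I') (extChartAt (I.prod I') p).symm
      (Set.range (I.prod I')) y =
    (mfderivWithin 𝓘(ℝ, E) I (extChartAt I p.1).symm (Set.range I) y.1).prodMap
      (mfderivWithin 𝓘(ℝ, E') I' (extChartAt I' p.2).symm (Set.range I') y.2) := by
  have hr : Set.range (I.prod I') = Set.range I ×ˢ Set.range I' := by
    rw [modelWithCorners_prod_coe, Set.range_prodMap]
  rw [extChartAt_prod] at hy ⊢
  have h₁ := mdifferentiableWithinAt_extChartAt_symm (I := I) hy.1
  have h₂ := mdifferentiableWithinAt_extChartAt_symm (I := I') hy.2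
  have := mfderivWithin_prodMap (p := y) h₁ h₂
    (I.uniqueMDiffOn _ (extChartAt_target_subset_range p.1 hy.1))
    (I'.uniqueMDiffOn _ (extChartAt_target_subset_range p.2 hy.2))
  rw [modelWithCornersSelf_prod, ← chartedSpaceSelf_prod, hr]
  exact this

lemma mfderiv_extChartAt_prod [IsManifold I 1 B] [IsManifold I' 1 F] (p : B × F) :
    mfderiv (I.prod I') 𝓘(ℝ, E × E') (extChartAt (I.prod I') p) p =
    (mfderiv I 𝓘(ℝ, E) (extChartAt I p.1) p.1).prodMap
      (mfderiv I' 𝓘(ℝ, E') (extChartAt I' p.2) p.2) := by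
  have h₁ := mdifferentiableAt_extChartAt (I := I) (mem_chart_source H p.1)
  have h₂ := mdifferentiableAt_extChartAt (I := I') (mem_chart_source H' p.2)
  have := mfderiv_prodMap (p := p) h₁ h₂
  rw [extChartAt_prod, modelWithCornersSelf_prod, ← chartedSpaceSelf_prod]
  exact this

variable [IsManifold I ∞ B] [IsManifold I' ∞ F] [CompleteSpace E] [CompleteSpace E']

lemma mpullbackWithin_prodLift (V : VField I B) (W : VField I' F) (p : B × F) {y : E × E'}
    (hy : y ∈ (extChartAt (I.prod I') p).target) :
    mpullbackWithin 𝓘(ℝ, E × E') (I.prod I') (extChartAt (I.prod I') p).symm (prodLift V W)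
      (Set.range (I.prod I')) y =
    Prod.map (mpullbackWithin 𝓘(ℝ, E) I (extChartAt I p.1).symm V (Set.range I))
      (mpullbackWithin 𝓘(ℝ, E') I' (extChartAt I' p.2).symm W (Set.range I')) y := by
  have hy' := hy
  rw [extChartAt_prod] at hy'
  rw [mpullbackWithin_apply, mfderivWithin_extChartAt_prod_symm p hy]
  have := inverse_prodMap (V := E) (V' := E') (W := E) (W' := E')
    (isInvertible_mfderivWithin_extChartAt_symm (I := I) hy'.1)
    (isInvertible_mfderivWithin_extChartAt_symm (I := I') hy'.2)
  erw [this]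
  rw [extChartAt_prod]
  rfl

/-- In a product chart the derivatives of the chart, of its inverse and of the lifted fields are all
block diagonal, so the bracket splits into its two factors. -/
lemma mlieBracket_prodLift {V₁ V₂ : VField I B} {W₁ W₂ : VField I' F} (hV₁ : IsSmoothVF I V₁)
    (hV₂ : IsSmoothVF I V₂) (hW₁ : IsSmoothVF I' W₁) (hW₂ : IsSmoothVF I' W₂) :
    mlieBracket (I.prod I') (prodLift V₁ W₁) (prodLift V₂ W₂) =
      prodLift (mlieBracket I V₁ V₂) (mlieBracket I' W₁ W₂) := by
  ext1 p
  have hdB : ∀ {V : VField I B}, IsSmoothVF I V → DifferentiableWithinAt ℝ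
      (mpullbackWithin 𝓘(ℝ, E) I (extChartAt I p.1).symm V (Set.range I)) (Set.range I)
      (extChartAt I p.1 p.1) := fun hV => by
    simpa using (hV.mdifferentiableAt p.1).mdifferentiableWithinAt
      (s := Set.univ).differentiableWithinAt_mpullbackWithin_vectorField
  have hdF : ∀ {V : VField I' F}, IsSmoothVF I' V → DifferentiableWithinAt ℝ
      (mpullbackWithin 𝓘(ℝ, E') I' (extChartAt I' p.2).symm V (Set.range I')) (Set.range I')
      (extChartAt I' p.2 p.2) := fun hV => by
    simpa using (hV.mdifferentiableAt p.2).mdifferentiableWithinAt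
      (s := Set.univ).differentiableWithinAt_mpullbackWithin_vectorField
  have hr : Set.range (I.prod I') = Set.range I ×ˢ Set.range I' := by
    rw [modelWithCorners_prod_coe, Set.range_prodMap]
  have hev : ∀ (V : VField I B) (W : VField I' F),
      mpullbackWithin 𝓘(ℝ, E × E') (I.prod I') (extChartAt (I.prod I') p).symm (prodLift V W)
      (Set.range (I.prod I')) =ᶠ[𝓝[Set.range (I.prod I')] (extChartAt (I.prod I') p p)]
      Prod.map (mpullbackWithin 𝓘(ℝ, E) I (extChartAt I p.1).symm V (Set.range I))
      (mpullbackWithin 𝓘(ℝ, E') I' (extChartAt I' p.2).symm W (Set.range I')) := by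
    intro V W
    filter_upwards [extChartAt_target_mem_nhdsWithin (I := I.prod I') p] with y hy
    exact mpullbackWithin_prodLift V W p hy
  rw [← mlieBracketWithin_univ, mlieBracketWithin_apply, Set.preimage_univ, Set.univ_inter,
    (hev V₁ W₁).lieBracketWithin_vectorField_eq_of_mem (hev V₂ W₂)
      (Set.mem_range_self _), hr, mfderiv_extChartAt_prod]
  have := inverse_prodMap (V := E) (V' := E') (W := E) (W' := E')
    (isInvertible_mfderiv_extChartAt (I := I) (mem_extChartAt_source p.1))
    (isInvertible_mfderiv_extChartAt (I := I') (mem_extChartAt_source p.2))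
  erw [this]
  rw [extChartAt_prod]
  have h2 := lieBracketWithin_prodMap (hdB hV₁) (hdB hV₂) (hdF hW₁) (hdF hW₂)
    (I.uniqueDiffOn _ (by simp [extChartAt])) (I'.uniqueDiffOn _ (by simp [extChartAt]))
  erw [h2]
  rw [prodLift, ← mlieBracketWithin_univ, mlieBracketWithin_apply, ← mlieBracketWithin_univ,
    mlieBracketWithin_apply, Set.preimage_univ, Set.univ_inter, Set.preimage_univ, Set.univ_inter]
  rfl

end ProductBracket

/-! ### Tangent vectors, forms and lifts on `B × F`; the warped metric -/

section Product

variable {E : Type*} [NormedAddCommGroup E] [NormedSpace ℝ E]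
  {H : Type*} [TopologicalSpace H] {I : ModelWithCorners ℝ E H}
  {E' : Type*} [NormedAddCommGroup E'] [NormedSpace ℝ E']
  {H' : Type*} [TopologicalSpace H'] {I' : ModelWithCorners ℝ E' H'}
  {B : Type*} [TopologicalSpace B] [ChartedSpace H B]
  {F : Type*} [TopologicalSpace F] [ChartedSpace H' F]
  {gB : BilinField I B} {gF : BilinField I' F} {J₁ : EndField I B} {J₂ : EndField I' F}
  {f : B → ℝ}

/-- The component along `B` of a vector tangent to `B × F`. -/
def tfst (p : B × F) : TangentSpace (I.prod I') p →L[ℝ] TangentSpace I p.1 :=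
  ContinuousLinearMap.fst ℝ (TangentSpace I p.1) (TangentSpace I' p.2)

/-- The component along `F` of a vector tangent to `B × F`. -/
def tsnd (p : B × F) : TangentSpace (I.prod I') p →L[ℝ] TangentSpace I' p.2 :=
  ContinuousLinearMap.snd ℝ (TangentSpace I p.1) (TangentSpace I' p.2)

/-- The vector tangent to `B × F` with given components. -/
def tmk (p : B × F) (v : TangentSpace I p.1) (w : TangentSpace I' p.2) :
    TangentSpace (I.prod I') p :=
  ((v, w) : TangentSpace I p.1 × TangentSpace I' p.2)

@[simp] lemma tfst_tmk (p : B × F) (v : TangentSpace I p.1) (w : TangentSpace I' p.2) :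
    tfst p (tmk p v w) = v := rfl

@[simp] lemma tsnd_tmk (p : B × F) (v : TangentSpace I p.1) (w : TangentSpace I' p.2) :
    tsnd p (tmk p v w) = w := rfl

lemma tangent_prod_ext {p : B × F} {v w : TangentSpace (I.prod I') p} (h₁ : tfst p v = tfst p w)
    (h₂ : tsnd p v = tsnd p w) : v = w :=
  Prod.ext (x := (v : E × E')) (y := (w : E × E')) h₁ h₂

@[simp] lemma tfst_prodLift (V : VField I B) (W : VField I' F) (p : B × F) :
    tfst p (prodLift V W p) = V p.1 := rfl

@[simp] lemma tsnd_prodLift (V : VField I B) (W : VField I' F) (p : B × F) :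
    tsnd p (prodLift V W p) = W p.2 := rfl

lemma warpedMetric_apply (p : B × F) (v w : TangentSpace (I.prod I') p) :
    warpedMetric I I' gB gF f p v w =
      gB p.1 (tfst p v) (tfst p w) + f p.1 ^ 2 * gF p.2 (tsnd p v) (tsnd p w) := by
  simp only [warpedMetric, mfderiv_fst, mfderiv_snd]
  rfl

@[simp] lemma tfst_prodStructure (p : B × F) (v : TangentSpace (I.prod I') p) :
    tfst p (prodStructure I I' J₁ J₂ p v) = J₁ p.1 (tfst p v) :=
  rfl

@[simp] lemma tsnd_prodStructure (p : B × F) (v : TangentSpace (I.prod I') p) :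
    tsnd p (prodStructure I I' J₁ J₂ p v) = J₂ p.2 (tsnd p v) :=
  rfl

/-- The pullback of a `1`-form under the projection `B × F → B`. -/
def fstForm (β : CovField I B) : CovField (I.prod I') (B × F) := fun p => (β p.1).comp (tfst p)

/-- The pullback of a `1`-form under the projection `B × F → F`. -/
def sndForm (α : CovField I' F) : CovField (I.prod I') (B × F) := fun p => (α p.2).comp (tsnd p)

@[simp] lemma fstForm_apply (β : CovField I B) (p : B × F) (v : TangentSpace (I.prod I') p) :
    fstForm (I' := I') β p v = β p.1 (tfst p v) := rfl

@[simp] lemma sndForm_apply (α : CovField I' F) (p : B × F) (v : TangentSpace (I.prod I') p) :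
    sndForm (I := I) α p v = α p.2 (tsnd p v) := rfl

variable [IsManifold I ∞ B] [IsManifold I' ∞ F]

lemma isSmoothVF_prodLift {V : VField I B} {W : VField I' F} (hV : IsSmoothVF I V)
    (hW : IsSmoothVF I' W) : IsSmoothVF (I.prod I') (prodLift V W) :=
  contMDiff_equivTangentBundleProd_symm.comp
    ((ContMDiff.comp hV contMDiff_fst).prodMk (ContMDiff.comp hW contMDiff_snd))

lemma IsSmoothVF.contMDiff_fst {X : VField (I.prod I') (B × F)} (hX : IsSmoothVF (I.prod I') X) :
    ContMDiff (I.prod I') (I.prod 𝓘(ℝ, E)) ∞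
      (fun p : B × F => TotalSpace.mk' E (E := TangentSpace I) p.1 (tfst p (X p))) :=
  _root_.contMDiff_fst.comp (contMDiff_equivTangentBundleProd.comp hX)

lemma IsSmoothVF.contMDiff_snd {X : VField (I.prod I') (B × F)} (hX : IsSmoothVF (I.prod I') X) :
    ContMDiff (I.prod I') (I'.prod 𝓘(ℝ, E')) ∞
      (fun p : B × F => TotalSpace.mk' E' (E := TangentSpace I') p.2 (tsnd p (X p))) :=
  _root_.contMDiff_snd.comp (contMDiff_equivTangentBundleProd.comp hX)

/-- Serves for bundle data evaluated along a projection: the base point `b x` then moves in a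
different manifold from `x`, and only the scalar fiber component is wanted. -/
lemma contMDiff_mk_trivial {N : Type*} [TopologicalSpace N] [ChartedSpace H N] {K : Type*}
    [TopologicalSpace K] [ChartedSpace H' K] {b : N → K} {h : N → ℝ}
    (hh : ContMDiff I (I'.prod 𝓘(ℝ, ℝ)) ∞
      (fun x => TotalSpace.mk' ℝ (E := fun _ : K => ℝ) (b x) (h x))) :
    ContMDiff I 𝓘(ℝ, ℝ) ∞ h := fun x => (contMDiffAt_totalSpace.1 (hh x)).2

variable [FiniteDimensional ℝ E] [FiniteDimensional ℝ E'] [T2Space B] [T2Space F]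

lemma isSmoothOneForm_fstForm {β : CovField I B} (hβ : IsSmoothOneForm I β) :
    IsSmoothOneForm (I.prod I') (fstForm (I' := I') (F := F) β) :=
  isSmoothOneForm_iff.2 fun _ hX => contMDiff_mk_trivial (I' := I)
    (ContMDiff.clm_bundle_apply (b := Prod.fst) (ContMDiff.comp hβ contMDiff_fst)
      hX.contMDiff_fst)

lemma isSmoothOneForm_sndForm {α : CovField I' F} (hα : IsSmoothOneForm I' α) :
    IsSmoothOneForm (I.prod I') (sndForm (I := I) (B := B) α) :=
  isSmoothOneForm_iff.2 fun _ hX => contMDiff_mk_trivial (I' := I')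
    (ContMDiff.clm_bundle_apply (b := Prod.snd) (ContMDiff.comp hα contMDiff_snd)
      hX.contMDiff_snd)

lemma isSingularMetric_warpedMetric (hB : IsSingularMetric I gB) (hF : IsSingularMetric I' gF)
    (hf : ContMDiff I 𝓘(ℝ, ℝ) ∞ f) :
    IsSingularMetric (I.prod I') (warpedMetric I I' gB gF f) where
  symm p v w := by rw [warpedMetric_apply, warpedMetric_apply, hB.symm, hF.symm]
  smooth := by
    refine contMDiff_bilinField_iff.2 fun X Y hX hY => ?_
    have h₁ : ContMDiff (I.prod I') 𝓘(ℝ, ℝ) ∞ fun p : B × F =>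
        gB p.1 (tfst p (X p)) (tfst p (Y p)) :=
      contMDiff_mk_trivial (I' := I) (ContMDiff.clm_bundle_apply (b := Prod.fst)
        (ContMDiff.clm_bundle_apply (b := Prod.fst) (ContMDiff.comp hB.smooth contMDiff_fst)
          hX.contMDiff_fst) hY.contMDiff_fst)
    have h₂ : ContMDiff (I.prod I') 𝓘(ℝ, ℝ) ∞ fun p : B × F =>
        gF p.2 (tsnd p (X p)) (tsnd p (Y p)) :=
      contMDiff_mk_trivial (I' := I') (ContMDiff.clm_bundle_apply (b := Prod.snd)
        (ContMDiff.clm_bundle_apply (b := Prod.snd) (ContMDiff.comp hF.smooth contMDiff_snd)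
          hX.contMDiff_snd) hY.contMDiff_snd)
    exact (h₁.add (((hf.comp contMDiff_fst).pow 2).mul h₂)).congr fun p => warpedMetric_apply _ _ _

lemma isAlmostProduct_warpedMetric (hB : IsAlmostProduct I gB J₁) (hF : IsAlmostProduct I' gF J₂)
    (hf : ContMDiff I 𝓘(ℝ, ℝ) ∞ f) :
    IsAlmostProduct (I.prod I') (warpedMetric I I' gB gF f) (prodStructure I I' J₁ J₂) where
  metric := isSingularMetric_warpedMetric hB.metric hF.metric hf
  smooth := by
    refine contMDiff_endField_iff.2 fun X hX => ?_
    exact contMDiff_equivTangentBundleProd_symm.comp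
      ((ContMDiff.clm_bundle_apply (b := Prod.fst) (ContMDiff.comp hB.smooth contMDiff_fst)
        hX.contMDiff_fst).prodMk
      (ContMDiff.clm_bundle_apply (b := Prod.snd) (ContMDiff.comp hF.smooth contMDiff_snd)
        hX.contMDiff_snd))
  involutive p v := tangent_prod_ext (by simp [hB.involutive]) (by simp [hF.involutive])
  isometric p v w := by
    simp [warpedMetric_apply, hB.isometric, hF.isometric]

lemma dirDeriv_prodLift_fst (V : VField I B) (W : VField I' F) {h : B → ℝ}
    (hh : ContMDiff I 𝓘(ℝ, ℝ) ∞ h) (p : B × F) :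
    dirDeriv (I.prod I') (prodLift V W) (fun q => h q.1) p = dirDeriv I V h p.1 := by
  have := mvfderiv_comp (I := I) (I' := I.prod I') (f := Prod.fst) (g := h) p
    ((hh p.1).mdifferentiableAt (by simp)) mdifferentiableAt_fst
  simp only [dirDeriv]
  erw [this]
  rw [mfderiv_fst]
  rfl

lemma dirDeriv_prodLift_snd (V : VField I B) (W : VField I' F) {h : F → ℝ}
    (hh : ContMDiff I' 𝓘(ℝ, ℝ) ∞ h) (p : B × F) :
    dirDeriv (I.prod I') (prodLift V W) (fun q => h q.2) p = dirDeriv I' W h p.2 := by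
  have := mvfderiv_comp (I := I') (I' := I.prod I') (f := Prod.snd) (g := h) p
    ((hh p.2).mdifferentiableAt (by simp)) mdifferentiableAt_snd
  simp only [dirDeriv]
  erw [this]
  rw [mfderiv_snd]
  rfl

/-- Every smooth field on `B × F` is near a given point generated by the lifts `(V, W)`. -/
lemma prodLift_induction {P : VField (I.prod I') (B × F) → Prop} (p : B × F)
    (hcongr : ∀ X Y, IsSmoothVF (I.prod I') X → IsSmoothVF (I.prod I') Y →
      (∀ᶠ q in 𝓝 p, X q = Y q) → P X → P Y)
    (hadd : ∀ X Y, IsSmoothVF (I.prod I') X → IsSmoothVF (I.prod I') Y → P X → P Y → P (X + Y))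
    (hsmul : ∀ (h : B × F → ℝ) X, ContMDiff (I.prod I') 𝓘(ℝ, ℝ) ∞ h → IsSmoothVF (I.prod I') X →
      P X → P (h • X))
    (hlift : ∀ (V : VField I B) (W : VField I' F), IsSmoothVF I V → IsSmoothVF I' W →
      P (prodLift V W))
    {X : VField (I.prod I') (B × F)} (hX : IsSmoothVF (I.prod I') X) : P X := by
  obtain ⟨s, θ, hs, hθ, h⟩ := exists_frame (I := I) p.1
  obtain ⟨t, τ, ht, hτ, h'⟩ := exists_frame (I := I') p.2
  have hzero : P 0 := by
    have := hlift 0 0 isSmoothVF_zero isSmoothVF_zero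
    exact this
  have hsum : ∀ {ι : Type} (A : Finset ι) (Y : ι → VField (I.prod I') (B × F)),
      (∀ i, IsSmoothVF (I.prod I') (Y i)) → (∀ i, P (Y i)) → P (∑ i ∈ A, Y i) := by
    classical
    intro ι A Y hY hP
    induction A using Finset.induction_on with
    | empty => simpa using hzero
    | insert i A hi ih =>
      rw [Finset.sum_insert hi]
      exact hadd _ _ (hY i) (IsSmoothVF.sum _ fun i _ => hY i) (hP i) ih
  have c₁ := fun i => (isSmoothOneForm_fstForm (I' := I') (F := F) (hθ i)).apply hX
  have c₂ := fun i => (isSmoothOneForm_sndForm (I := I) (B := B) (hτ i)).apply hX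
  have l₁ := fun i => isSmoothVF_prodLift (I' := I') (F := F) (hs i) isSmoothVF_zero
  have l₂ := fun i => isSmoothVF_prodLift (I := I) (B := B) isSmoothVF_zero (ht i)
  have s₁ := fun i => (l₁ i).smul (c₁ i)
  have s₂ := fun i => (l₂ i).smul (c₂ i)
  -- Frames of `B` and `F`, each lifted with zero in the other factor, together form a frame of `B ×
  -- F`; the coefficients are the pulled-back coframes applied to `X`.
  refine hcongr _ X ((IsSmoothVF.sum Finset.univ fun i _ => s₁ i).add
    (IsSmoothVF.sum Finset.univ fun i _ => s₂ i)) hX ?_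
    (hadd _ _ (IsSmoothVF.sum _ fun i _ => s₁ i) (IsSmoothVF.sum _ fun i _ => s₂ i)
      (hsum _ _ s₁ fun i => hsmul _ _ (c₁ i) (l₁ i) (hlift _ _ (hs i) isSmoothVF_zero))
      (hsum _ _ s₂ fun i => hsmul _ _ (c₂ i) (l₂ i) (hlift _ _ isSmoothVF_zero (ht i))))
  filter_upwards [h.prod_inl_nhds p.2, h'.prod_inr_nhds p.1] with q hq hq'
  refine tangent_prod_ext ?_ ?_
  · conv_rhs => rw [hq (tfst q (X q))]
    simp
  · conv_rhs => rw [hq' (tsnd q (X q))]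
    simp

end Product

/-! ### Koszul forms and lower derivatives of a warped product on lifts -/

section WarpedKoszul

variable {E : Type*} [NormedAddCommGroup E] [NormedSpace ℝ E] [FiniteDimensional ℝ E]
  {H : Type*} [TopologicalSpace H] {I : ModelWithCorners ℝ E H}
  {E' : Type*} [NormedAddCommGroup E'] [NormedSpace ℝ E'] [FiniteDimensional ℝ E']
  {H' : Type*} [TopologicalSpace H'] {I' : ModelWithCorners ℝ E' H'}
  {B : Type*} [TopologicalSpace B] [ChartedSpace H B] [IsManifold I ∞ B] [T2Space B]
  {F : Type*} [TopologicalSpace F] [ChartedSpace H' F] [IsManifold I' ∞ F] [T2Space F]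
  {gB : BilinField I B} {gF : BilinField I' F} {J₁ : EndField I B} {J₂ : EndField I' F}
  {f : B → ℝ} {V V' V'' : VField I B} {W W' W'' : VField I' F}

lemma pairing_prodLift (p : B × F) :
    pairing (I.prod I') (warpedMetric I I' gB gF f) (prodLift V W) (prodLift V' W') p =
      pairing I gB V V' p.1 + f p.1 ^ 2 * pairing I' gF W W' p.2 := by
  simp [pairing, warpedMetric_apply]

lemma dirDeriv_pairing_prodLift (hB : IsSingularMetric I gB) (hF : IsSingularMetric I' gF)
    (hf : ContMDiff I 𝓘(ℝ, ℝ) ∞ f) (hV' : IsSmoothVF I V') (hV'' : IsSmoothVF I V'')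
    (hW' : IsSmoothVF I' W') (hW'' : IsSmoothVF I' W'') (p : B × F) :
    dirDeriv (I.prod I') (prodLift V W)
      (pairing (I.prod I') (warpedMetric I I' gB gF f) (prodLift V' W') (prodLift V'' W'')) p =
      dirDeriv I V (pairing I gB V' V'') p.1 +
        f p.1 ^ 2 * dirDeriv I' W (pairing I' gF W' W'') p.2 +
        2 * f p.1 * dirDeriv I V f p.1 * pairing I' gF W' W'' p.2 := by
  have e : pairing (I.prod I') (warpedMetric I I' gB gF f) (prodLift V' W') (prodLift V'' W'') =
      (fun q : B × F => pairing I gB V' V'' q.1) + ((fun q => (f * f) q.1) *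
        fun q => pairing I' gF W' W'' q.2) := by
    ext q
    rw [pairing_prodLift]
    simp [pow_two]
  have h₁ := hB.contMDiff_pairing hV' hV''
  have h₂ := hF.contMDiff_pairing hW' hW''
  have hff : ContMDiff I 𝓘(ℝ, ℝ) ∞ (f * f) := hf.mul hf
  have hff' : ContMDiff (I.prod I') 𝓘(ℝ, ℝ) ∞ (fun q : B × F => (f * f) q.1) :=
    hff.comp contMDiff_fst
  have h₂' : ContMDiff (I.prod I') 𝓘(ℝ, ℝ) ∞ (fun q : B × F => pairing I' gF W' W'' q.2) :=
    h₂.comp contMDiff_snd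
  have h₁' : ContMDiff (I.prod I') 𝓘(ℝ, ℝ) ∞ (fun q : B × F => pairing I gB V' V'' q.1) :=
    h₁.comp contMDiff_fst
  rw [e, dirDeriv_add _ h₁' (hff'.mul h₂'), dirDeriv_mul _ hff' h₂',
    dirDeriv_prodLift_fst _ _ h₁, dirDeriv_prodLift_fst _ _ hff, dirDeriv_prodLift_snd _ _ h₂,
    dirDeriv_mul _ hf hf]
  simp only [Pi.mul_apply]
  ring

/-- The Koszul form of a warped product on lifts. -/
lemma koszul_prodLift (hB : IsSingularMetric I gB) (hF : IsSingularMetric I' gF)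
    (hf : ContMDiff I 𝓘(ℝ, ℝ) ∞ f) (hV : IsSmoothVF I V) (hV' : IsSmoothVF I V')
    (hV'' : IsSmoothVF I V'') (hW : IsSmoothVF I' W) (hW' : IsSmoothVF I' W')
    (hW'' : IsSmoothVF I' W'') (p : B × F) :
    koszul (I.prod I') (warpedMetric I I' gB gF f) (prodLift V W) (prodLift V' W')
      (prodLift V'' W'') p =
      koszul I gB V V' V'' p.1 + f p.1 ^ 2 * koszul I' gF W W' W'' p.2 +
        f p.1 * (dirDeriv I V f p.1 * pairing I' gF W' W'' p.2 +
          dirDeriv I V' f p.1 * pairing I' gF W'' W p.2 -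
          dirDeriv I V'' f p.1 * pairing I' gF W W' p.2) := by
  simp only [koszul]
  rw [dirDeriv_pairing_prodLift hB hF hf hV' hV'' hW' hW'',
    dirDeriv_pairing_prodLift hB hF hf hV'' hV hW'' hW,
    dirDeriv_pairing_prodLift hB hF hf hV hV' hW hW',
    mlieBracket_prodLift hV' hV'' hW' hW'', mlieBracket_prodLift hV'' hV hW'' hW,
    mlieBracket_prodLift hV hV' hW hW', pairing_prodLift, pairing_prodLift, pairing_prodLift]
  ring

/-- The almost product Koszul form of a warped product on lifts. -/
lemma apKoszul_prodLift (hB : IsAlmostProduct I gB J₁) (hF : IsAlmostProduct I' gF J₂)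
    (hf : ContMDiff I 𝓘(ℝ, ℝ) ∞ f) (hV : IsSmoothVF I V) (hV' : IsSmoothVF I V')
    (hV'' : IsSmoothVF I V'') (hW : IsSmoothVF I' W) (hW' : IsSmoothVF I' W')
    (hW'' : IsSmoothVF I' W'') (p : B × F) :
    apKoszul (I.prod I') (warpedMetric I I' gB gF f) (prodStructure I I' J₁ J₂) (prodLift V W)
      (prodLift V' W') (prodLift V'' W'') p =
      apKoszul I gB J₁ V V' V'' p.1 + f p.1 ^ 2 * apKoszul I' gF J₂ W W' W'' p.2 +
        f p.1 * (dirDeriv I V f p.1 * gF p.2 (W' p.2) (W'' p.2) +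
          2⁻¹ * mvfderiv I f p.1 (V' p.1) * gF p.2 (W p.2) (W'' p.2) +
          2⁻¹ * mvfderiv I f p.1 (J₁ p.1 (V' p.1)) * gF p.2 (J₂ p.2 (W p.2)) (W'' p.2) -
          2⁻¹ * mvfderiv I f p.1 (V'' p.1) * gF p.2 (W p.2) (W' p.2) -
          2⁻¹ * mvfderiv I f p.1 (J₁ p.1 (V'' p.1)) * gF p.2 (W p.2) (J₂ p.2 (W' p.2))) := by
  have e₁ : (fun q => prodStructure I I' J₁ J₂ q (prodLift V' W' q)) =
      prodLift (fun q => J₁ q (V' q)) (fun q => J₂ q (W' q)) := rfl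
  have e₂ : (fun q => prodStructure I I' J₁ J₂ q (prodLift V'' W'' q)) =
      prodLift (fun q => J₁ q (V'' q)) (fun q => J₂ q (W'' q)) := rfl
  simp only [apKoszul]
  rw [e₁, e₂, koszul_prodLift hB.metric hF.metric hf hV hV' hV'' hW hW' hW'',
    koszul_prodLift hB.metric hF.metric hf hV (hB.smoothVF hV') (hB.smoothVF hV'') hW
      (hF.smoothVF hW') (hF.smoothVF hW''), hF.pairing_endField]
  have s₁ := hF.metric.symm p.2 (W'' p.2) (W p.2)
  -- An isometric involution is self-adjoint.
  have s₂ : gF p.2 (J₂ p.2 (W'' p.2)) (W p.2) = gF p.2 (J₂ p.2 (W p.2)) (W'' p.2) := by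
    rw [← hF.isometric, hF.involutive, hF.metric.symm]
  simp only [pairing, dirDeriv, s₁, s₂]
  ring

/-- The differential of a function. -/
def dForm (f : B → ℝ) : CovField I B := fun p => mvfderiv I f p

/-- The composition of a `1`-form with a field of endomorphisms. -/
def compEnd (β : CovField I B) (J₁ : EndField I B) : CovField I B := fun p => (β p).comp (J₁ p)

@[simp] lemma dForm_apply (p : B) (v : TangentSpace I p) :
    dForm (I := I) f p v = mvfderiv I f p v := rfl

@[simp] lemma compEnd_apply (β : CovField I B) (p : B) (v : TangentSpace I p) :
    compEnd β J₁ p v = β p (J₁ p v) := rfl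

lemma isSmoothOneForm_dForm (hf : ContMDiff I 𝓘(ℝ, ℝ) ∞ f) :
    IsSmoothOneForm I (dForm (I := I) f) :=
  isSmoothOneForm_iff.2 fun _ hX => contMDiff_dirDeriv hX hf

lemma IsAlmostProduct.isSmoothOneForm_compEnd (hB : IsAlmostProduct I gB J₁) {β : CovField I B}
    (hβ : IsSmoothOneForm I β) : IsSmoothOneForm I (compEnd β J₁) :=
  isSmoothOneForm_iff.2 fun _ hX => hβ.apply (hB.smoothVF hX)

/-- The part of `∇̃♭` of a warped product which comes from the warping function; here `b` and `c`
stand for `g_F(W, W')` and `g_F(W, J₂ W')`. -/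
def gradForm (f : B → ℝ) (J₁ : EndField I B) (b c : F → ℝ) : CovField (I.prod I') (B × F) :=
  fun p => (2⁻¹ * b p.2) • fstForm (dForm f) p + (2⁻¹ * c p.2) • fstForm (compEnd (dForm f) J₁) p

@[simp] lemma gradForm_apply (b c : F → ℝ) (p : B × F) (v : TangentSpace (I.prod I') p) :
    gradForm f J₁ b c p v = 2⁻¹ * b p.2 * mvfderiv I f p.1 (tfst p v) +
      2⁻¹ * c p.2 * mvfderiv I f p.1 (J₁ p.1 (tfst p v)) := rfl

lemma IsAlmostProduct.isSmoothOneForm_gradForm (hB : IsAlmostProduct I gB J₁)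
    (hf : ContMDiff I 𝓘(ℝ, ℝ) ∞ f) {b c : F → ℝ} (hb : ContMDiff I' 𝓘(ℝ, ℝ) ∞ b)
    (hc : ContMDiff I' 𝓘(ℝ, ℝ) ∞ c) :
    IsSmoothOneForm (I.prod I') (gradForm (I' := I') f J₁ b c) :=
  ((isSmoothOneForm_fstForm (isSmoothOneForm_dForm hf)).smul
    (h := fun p : B × F => 2⁻¹ * b p.2) (contMDiff_const.mul (hb.comp contMDiff_snd))).add
  ((isSmoothOneForm_fstForm (hB.isSmoothOneForm_compEnd (isSmoothOneForm_dForm hf))).smul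
    (h := fun p : B × F => 2⁻¹ * c p.2) (contMDiff_const.mul (hc.comp contMDiff_snd)))

/-- The almost product lower derivative of a warped product on lifts. -/
lemma apLowerDeriv_prodLift (hB : IsAlmostProduct I gB J₁) (hF : IsAlmostProduct I' gF J₂)
    (hf : ContMDiff I 𝓘(ℝ, ℝ) ∞ f) (hV : IsSmoothVF I V) (hV' : IsSmoothVF I V')
    (hW : IsSmoothVF I' W) (hW' : IsSmoothVF I' W') (p : B × F) :
    apLowerDeriv (I.prod I') (warpedMetric I I' gB gF f) (prodStructure I I' J₁ J₂) (prodLift V W)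
      (prodLift V' W') p =
      fstForm (apLowerDeriv I gB J₁ V V') p +
      f p.1 ^ 2 • sndForm (apLowerDeriv I' gF J₂ W W') p +
      dirDeriv I V f p.1 • f p.1 • sndForm (lowering gF W') p +
      (2⁻¹ * mvfderiv I f p.1 (V' p.1)) • f p.1 • sndForm (lowering gF W) p +
      (2⁻¹ * mvfderiv I f p.1 (J₁ p.1 (V' p.1))) • f p.1 •
        sndForm (lowering gF fun q => J₂ q (W q)) p +
      (- f p.1) • gradForm f J₁ (pairing I' gF W W') (pairing I' gF W fun q => J₂ q (W' q)) p := by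
  ext v
  -- Every tangent vector of the product is the value of a lift, so the formula for the Koszul form
  -- on lifts determines the covector.
  obtain ⟨V'', hV'', hv₁⟩ := exists_smoothVF_eq (I := I) p.1 (tfst p v)
  obtain ⟨W'', hW'', hv₂⟩ := exists_smoothVF_eq (I := I') p.2 (tsnd p v)
  have hv : v = prodLift V'' W'' p := tangent_prod_ext hv₁.symm hv₂.symm
  rw [hv, (isAlmostProduct_warpedMetric hB hF hf).apLowerDeriv_apply (isSmoothVF_prodLift hV hW)
    (isSmoothVF_prodLift hV' hW') (isSmoothVF_prodLift hV'' hW''),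
    apKoszul_prodLift hB hF hf hV hV' hV'' hW hW' hW'',
    ← hB.apLowerDeriv_apply hV hV' hV'', ← hF.apLowerDeriv_apply hW hW' hW'']
  simp [lowering, pairing]
  ring

end WarpedKoszul

/-! ### Raising `1`-forms smoothly with a non-degenerate metric -/

section Raise

variable {E : Type*} [NormedAddCommGroup E] [NormedSpace ℝ E] [FiniteDimensional ℝ E]
  {H : Type*} [TopologicalSpace H] {I : ModelWithCorners ℝ E H}
  {B : Type*} [TopologicalSpace B] [ChartedSpace H B]
  {gB : BilinField I B}

lemma IsNondegenerate.exists_eq (hnd : IsNondegenerate I gB) (p : B)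
    (β : TangentSpace I p →L[ℝ] ℝ) : ∃ u, β = gB p u := by
  have hinj : Function.Injective (gB p) := by
    refine (injective_iff_map_eq_zero (gB p)).2 fun v hv => hnd p v fun w => ?_
    rw [hv]; rfl
  have hr : Module.finrank ℝ (TangentSpace I p) =
      Module.finrank ℝ (TangentSpace I p →L[ℝ] ℝ) :=
    (Subspace.dual_finrank_eq (K := ℝ) (V := TangentSpace I p)).symm.trans
      (LinearMap.toContinuousLinearMap (𝕜 := ℝ) (E := TangentSpace I p) (F' := ℝ)).finrank_eq
  obtain ⟨u, hu⟩ := (LinearMap.injective_iff_surjective_of_finrank_eq_finrank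
    (f := (gB p).toLinearMap) hr).1 hinj β
  exact ⟨u, hu.symm⟩

lemma contMDiff_det {n : ℕ} {A : B → Matrix (Fin n) (Fin n) ℝ}
    (hA : ∀ i j, ContMDiff I 𝓘(ℝ, ℝ) ∞ fun q => A q i j) :
    ContMDiff I 𝓘(ℝ, ℝ) ∞ fun q => (A q).det := by
  simp only [Matrix.det_apply']
  exact contMDiff_finsetSum fun σ _ => contMDiff_const.mul (contMDiff_finsetProd fun i _ => hA _ _)

variable [IsManifold I ∞ B] [T2Space B]

/-- On a non-degenerate manifold every smooth `1`-form is `g(U, ·)` for a smooth field `U`. -/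
lemma IsNondegenerate.exists_lowering_eq (hnd : IsNondegenerate I gB)
    (hB : IsSingularMetric I gB) {β : CovField I B} (hβ : IsSmoothOneForm I β) :
    ∃ U : VField I B, IsSmoothVF I U ∧ β = lowering gB U := by
  choose U hU using fun p => hnd.exists_eq p (β p)
  refine ⟨U, fun p => ?_, funext hU⟩
  obtain ⟨s, θ, hs, hθ, hexp⟩ := exists_frame (I := I) p
  let G : B → Matrix (Fin (Module.finrank ℝ E)) (Fin (Module.finrank ℝ E)) ℝ :=
    fun q i j => gB q (s i q) (s j q)
  have hG : ∀ i j, ContMDiff I 𝓘(ℝ, ℝ) ∞ fun q => G q i j := fun i j =>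
    hB.contMDiff_pairing (hs i) (hs j)
  have hdet := contMDiff_det hG
  -- A kernel vector `x` of the Gram matrix would make `∑ xⱼ sⱼ` orthogonal to all vectors, hence
  -- zero, against the independence of the frame at `p`.
  have hdetp : (G p).det ≠ 0 := by
    intro h0
    obtain ⟨x, hx, hGx⟩ := Matrix.exists_mulVec_eq_zero_iff.2 h0
    have hli : LinearIndependent ℝ (fun i => s i p) := by
      refine linearIndependent_of_top_le_span_of_card_eq_finrank (fun v _ => ?_)
        (by rw [Fintype.card_fin]; rfl)
      rw [hexp.self_of_nhds v]
      exact Submodule.sum_mem _ fun i _ => Submodule.smul_mem _ _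
        (Submodule.subset_span ⟨i, rfl⟩)
    have hsum : ∑ j, x j • s j p = 0 := by
      refine hnd p _ fun w => ?_
      have hs0 : ∀ i, gB p (s i p) (∑ j, x j • s j p) = 0 := fun i => by
        have := congrFun hGx i
        simpa [Matrix.mulVec, dotProduct, G, mul_comm] using this
      rw [hB.symm, hexp.self_of_nhds w, map_sum (gB p), sum_apply]
      exact Finset.sum_eq_zero fun i _ => by rw [map_smul, smul_apply, hs0, smul_zero]
    exact hx (funext (Fintype.linearIndependent_iff.1 hli x hsum))
  -- The numerators in Cramer's rule: near `p` the frame coefficients of `U` are `C j / det G`,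
  -- which are smooth although `U` was chosen pointwise.
  let C : Fin (Module.finrank ℝ E) → B → ℝ := fun j q =>
    ((G q).updateCol j fun i => β q (s i q)).det
  have hC : ∀ j, ContMDiff I 𝓘(ℝ, ℝ) ∞ (C j) := by
    refine fun j => contMDiff_det fun i k => ?_
    by_cases hk : k = j
    · subst hk
      simpa using hβ.apply (hs i)
    · simpa [Matrix.updateCol_apply, hk] using hG i k
  have hUeq : ∀ᶠ q in 𝓝 p, U q = ∑ j, ((G q).det⁻¹ * C j q) • s j q := by
    filter_upwards [hexp, hdet.continuous.continuousAt.eventually_ne hdetp] with q hq hdq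
    have hb : (fun i => β q (s i q)) = (G q).mulVec fun j => θ j q (U q) := by
      ext i
      rw [hU q, hB.symm]
      conv_lhs => rw [hq (U q)]
      simp [Matrix.mulVec, dotProduct, G, mul_comm]
    have hc : ∀ j, C j q = (G q).det * θ j q (U q) := by
      intro j
      have := congrFun (Matrix.cramer_eq_adjugate_mulVec (G q) fun i => β q (s i q)) j
      rw [Matrix.cramer_apply] at this
      simp only [C]
      rw [this, hb, Matrix.mulVec_mulVec, Matrix.adjugate_mul]
      simp [Matrix.smul_mulVec]
    conv_lhs => rw [hq (U q)]
    refine Finset.sum_congr rfl fun j _ => ?_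
    rw [hc, inv_mul_cancel_left₀ hdq]
  have h₁ : ContMDiffAt I (I.prod 𝓘(ℝ, E)) ∞
      (fun q => TotalSpace.mk' E q (∑ j, ((G q).det⁻¹ * C j q) • s j q)) p :=
    ContMDiffAt.sum_section fun j _ => ContMDiffAt.smul_section
      (((hdet p).inv₀ hdetp).mul (hC j p)) (hs j p)
  refine h₁.congr_of_eventuallyEq ?_
  filter_upwards [hUeq] with q hq
  rw [hq]

end Raise

/-! ### The lower derivatives lie in the image of the warped metric -/

section Lowered

variable {E : Type*} [NormedAddCommGroup E] [NormedSpace ℝ E] [FiniteDimensional ℝ E]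
  {H : Type*} [TopologicalSpace H] {I : ModelWithCorners ℝ E H}
  {E' : Type*} [NormedAddCommGroup E'] [NormedSpace ℝ E'] [FiniteDimensional ℝ E']
  {H' : Type*} [TopologicalSpace H'] {I' : ModelWithCorners ℝ E' H'}
  {B : Type*} [TopologicalSpace B] [ChartedSpace H B]
  {F : Type*} [TopologicalSpace F] [ChartedSpace H' F]
  {gB : BilinField I B} {gF : BilinField I' F} {J₁ : EndField I B} {J₂ : EndField I' F}
  {f : B → ℝ} {V V' : VField I B} {W W' : VField I' F} {p : B × F}

lemma warpedMetric_tmk_zero_right {β : CovField I B} {u : TangentSpace I p.1}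
    (hu : β p.1 = gB p.1 u) : fstForm β p = warpedMetric I I' gB gF f p (tmk p u 0) := by
  ext v
  simp [warpedMetric_apply, hu]

/-- The hypothesis is not divided by `f`, so that it is also available, and trivially true, at the
zeros of `f`. -/
lemma warpedMetric_tmk_zero_left {α : CovField I' F} {w : TangentSpace I' p.2}
    (hw : f p.1 • α p.2 = f p.1 ^ 2 • gF p.2 w) :
    f p.1 • sndForm α p = warpedMetric I I' gB gF f p (tmk p 0 w) := by
  ext v
  have := DFunLike.congr_fun hw (tsnd p v)
  simp only [smul_apply] at this
  simpa [warpedMetric_apply] using this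

lemma IsNondegenerate.lowered_fstForm (hnd : IsNondegenerate I gB) (β : CovField I B) :
    ∃ v, fstForm β p = warpedMetric I I' gB gF f p v := by
  obtain ⟨u, hu⟩ := hnd.exists_eq p.1 (β p.1)
  exact ⟨_, warpedMetric_tmk_zero_right hu⟩

/-- A single factor `f` suffices: the metric supplies `f²`, and `f⁻¹ w` absorbs the excess. At a
zero of `f` the form is zero, and the convention `0⁻¹ = 0` makes the same witness work. -/
lemma lowered_smul_sndForm {α : CovField I' F} (hα : ∃ w, α p.2 = gF p.2 w) :
    ∃ v, f p.1 • sndForm α p = warpedMetric I I' gB gF f p v := by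
  obtain ⟨w, hw⟩ := hα
  refine ⟨_, warpedMetric_tmk_zero_left (w := (f p.1)⁻¹ • w) ?_⟩
  by_cases h0 : f p.1 = 0
  · simp [h0]
  · rw [map_smul, hw, smul_smul]
    congr 1
    field_simp

variable [IsManifold I ∞ B] [T2Space B] [IsManifold I' ∞ F] [T2Space F]

lemma IsNondegenerate.lowered_gradForm (hnd : IsNondegenerate I gB)
    (b c : F → ℝ) :
    ∃ v, gradForm f J₁ b c p = warpedMetric I I' gB gF f p v :=
  lowered_add (lowered_smul _ (hnd.lowered_fstForm _)) (lowered_smul _ (hnd.lowered_fstForm _))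

/-- The almost product lower derivatives of a warped product are in the image of the metric. -/
lemma lowered_apLowerDeriv_warpedMetric (hB : IsAlmostProduct I gB J₁)
    (hnd : IsNondegenerate I gB) (hF : IsAlmostProduct I' gF J₂)
    (hlow : ∀ W W' : VField I' F, IsSmoothVF I' W → IsSmoothVF I' W' → ∀ q,
      ∃ v, apLowerDeriv I' gF J₂ W W' q = gF q v)
    (hf : ContMDiff I 𝓘(ℝ, ℝ) ∞ f) (X Y : VField (I.prod I') (B × F))
    (hX : IsSmoothVF (I.prod I') X) (hY : IsSmoothVF (I.prod I') Y) (p : B × F) :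
    ∃ v, apLowerDeriv (I.prod I') (warpedMetric I I' gB gF f) (prodStructure I I' J₁ J₂) X Y p =
      warpedMetric I I' gB gF f p v := by
  have hJ := isAlmostProduct_warpedMetric hB hF hf
  refine prodLift_induction (P := fun X => ∃ v, apLowerDeriv (I.prod I')
    (warpedMetric I I' gB gF f) (prodStructure I I' J₁ J₂) X Y p =
      warpedMetric I I' gB gF f p v) p ?_ ?_ ?_ ?_ hX
  · intro X X' hX hX' he h
    rwa [← hJ.apLowerDeriv_congr hX hX' hY hY he (Filter.Eventually.of_forall fun _ => rfl)]
  · intro X X' hX hX' h h'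
    rw [hJ.apLowerDeriv_add_first hX hX' hY]
    exact lowered_add h h'
  · intro h X hh hX hP
    rw [hJ.apLowerDeriv_smul_first hX hY hh]
    exact lowered_smul _ hP
  intro V W hV hW
  have hX := isSmoothVF_prodLift hV hW
  refine prodLift_induction (P := fun Y => ∃ v, apLowerDeriv (I.prod I')
    (warpedMetric I I' gB gF f) (prodStructure I I' J₁ J₂) (prodLift V W) Y p =
      warpedMetric I I' gB gF f p v) p ?_ ?_ ?_ ?_ hY
  · intro Y Y' hY hY' he h
    rwa [← hJ.apLowerDeriv_congr hX hX hY hY' (Filter.Eventually.of_forall fun _ => rfl) he]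
  · intro Y Y' hY hY' h h'
    rw [hJ.apLowerDeriv_add_second hX hY hY']
    exact lowered_add h h'
  · intro h Y hh hY hP
    rw [hJ.apLowerDeriv_smul_second hX hY hh]
    exact lowered_add (lowered_smul _ hP) (lowered_smul _ ⟨Y p, rfl⟩)
  intro V' W' hV' hW'
  -- Splitting `f²` exposes one factor `f` next to the fiber form, as `lowered_smul_sndForm`
  -- requires.
  rw [apLowerDeriv_prodLift hB hF hf hV hV' hW hW', pow_two, mul_smul]
  exact lowered_add (lowered_add (lowered_add (lowered_add (lowered_add (hnd.lowered_fstForm _)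
    (lowered_smul _ (lowered_smul_sndForm (hlow W W' hW hW' _))))
    (lowered_smul _ (lowered_smul_sndForm ⟨_, rfl⟩)))
    (lowered_smul _ (lowered_smul_sndForm ⟨_, rfl⟩)))
    (lowered_smul _ (lowered_smul_sndForm ⟨_, rfl⟩)))
    (lowered_smul _ (hnd.lowered_gradForm _ _))

end Lowered

/-! ### Additivity of the signature under orthogonal sums -/

section Signature

open QuadraticMap

variable {V W : Type*} [AddCommGroup V] [Module ℝ V] [FiniteDimensional ℝ V] [AddCommGroup W]
  [Module ℝ W] [FiniteDimensional ℝ W]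

/-- Diagonalizing both forms diagonalizes their sum, and positive weights are counted separately in
the two index sets. -/
lemma sigPos_prod (Q : QuadraticForm ℝ V) (Q' : QuadraticForm ℝ W) :
    sigPos (Q.prod Q') = sigPos Q + sigPos Q' := by
  obtain ⟨w, hw⟩ := Q.equivalent_weightedSumSquares
  obtain ⟨w', hw'⟩ := Q'.equivalent_weightedSumSquares
  have he : ((weightedSumSquares ℝ w).prod (weightedSumSquares ℝ w')).Equivalent
      (weightedSumSquares ℝ (Sum.elim w w')) :=
    ⟨{ (LinearEquiv.sumArrowLequivProdArrow _ _ ℝ ℝ).symm with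
        map_app' := fun x => by
          simp [weightedSumSquares_apply, Fintype.sum_sum_type]
          rfl }⟩
  rw [QuadraticForm.sigPos_of_equiv_weightedSumSquares ((hw.prod hw').trans he),
    QuadraticForm.sigPos_of_equiv_weightedSumSquares hw,
    QuadraticForm.sigPos_of_equiv_weightedSumSquares hw']
  have : {i | 0 < Sum.elim w w' i} = Sum.inl '' {i | 0 < w i} ∪ Sum.inr '' {i | 0 < w' i} := by
    ext (i | i) <;> simp
  rw [this, Set.ncard_union_eq (by simp [Set.disjoint_left]),
    Set.ncard_image_of_injective _ Sum.inl_injective,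
    Set.ncard_image_of_injective _ Sum.inr_injective]

lemma sigNeg_prod (Q : QuadraticForm ℝ V) (Q' : QuadraticForm ℝ W) :
    sigNeg (Q.prod Q') = sigNeg Q + sigNeg Q' := by
  have : -(Q.prod Q') = (-Q).prod (-Q') := by
    ext x
    simp [add_comm]
  rw [← sigPos_neg, this, sigPos_prod, sigPos_neg, sigPos_neg]

lemma sigPos_zero : sigPos (0 : QuadraticForm ℝ V) = 0 := by
  have h := QuadraticForm.sigPos_add_finrank_le_of_nonpos (Q := (0 : QuadraticForm ℝ V))
    (V := ⊤) (by simp)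
  simp only [finrank_top] at h
  omega

lemma sigNeg_zero : sigNeg (0 : QuadraticForm ℝ V) = 0 := by
  rw [← sigPos_neg, neg_zero, sigPos_zero]

end Signature

/-! ### Signature, radical and rank of a metric -/

section MetricSignature

open QuadraticMap

variable {E : Type*} [NormedAddCommGroup E] [NormedSpace ℝ E] [FiniteDimensional ℝ E]
  {H : Type*} [TopologicalSpace H] {I : ModelWithCorners ℝ E H}
  {M : Type*} [TopologicalSpace M] [ChartedSpace H M] {g : BilinField I M}

@[simp] lemma quadForm_apply (p : M) (v : TangentSpace I p) : quadForm I g p v = g p v v := rfl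

lemma mem_radical_quadForm (hg : ∀ (p : M) (v w : TangentSpace I p), g p v w = g p w v) {p : M}
    {v : TangentSpace I p} : v ∈ (quadForm I g p).radical ↔ ∀ w, g p v w = 0 := by
  rw [QuadraticMap.mem_radical_iff']
  simp only [quadForm_apply, map_add, _root_.add_apply]
  constructor
  · intro h w
    have := h.2 w
    rw [h.1, hg p w v] at this
    linarith
  · intro h
    exact ⟨h v, fun w => by rw [hg p w v, h, h]; ring⟩

lemma IsNondegenerate.sigPos_add_sigNeg (hnd : IsNondegenerate I g)
    (hg : ∀ (p : M) (v w : TangentSpace I p), g p v w = g p w v) (p : M) :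
    sigPos (quadForm I g p) + sigNeg (quadForm I g p) = Module.finrank ℝ E := by
  have h : (quadForm I g p).radical = ⊥ :=
    (Submodule.eq_bot_iff _).2 fun v hv => hnd p v ((mem_radical_quadForm hg).1 hv)
  have := QuadraticForm.sigPos_add_sigNeg_add_radical (Q := quadForm I g p)
  rw [h, finrank_bot, add_zero] at this
  exact this

lemma eq_zero_of_sigPos_sigNeg_eq_zero
    (hg : ∀ (p : M) (v w : TangentSpace I p), g p v w = g p w v) {p : M}
    (h₁ : sigPos (quadForm I g p) = 0) (h₂ : sigNeg (quadForm I g p) = 0)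
    (v w : TangentSpace I p) : g p v w = 0 := by
  have h := QuadraticForm.sigPos_add_sigNeg_add_radical (Q := quadForm I g p)
  rw [h₁, h₂, zero_add, zero_add] at h
  have h := Submodule.eq_top_of_finrank_eq h
  exact (mem_radical_quadForm hg).1 (h ▸ Submodule.mem_top) w

end MetricSignature

/-! ### Regions of constant signature of a warped product -/

section WarpedSignature

open QuadraticMap

variable {E : Type*} [NormedAddCommGroup E] [NormedSpace ℝ E] [FiniteDimensional ℝ E]
  {H : Type*} [TopologicalSpace H] {I : ModelWithCorners ℝ E H}
  {E' : Type*} [NormedAddCommGroup E'] [NormedSpace ℝ E'] [FiniteDimensional ℝ E']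
  {H' : Type*} [TopologicalSpace H'] {I' : ModelWithCorners ℝ E' H'}
  {B : Type*} [TopologicalSpace B] [ChartedSpace H B]
  {F : Type*} [TopologicalSpace F] [ChartedSpace H' F]
  {gB : BilinField I B} {gF : BilinField I' F} {f : B → ℝ} {p : B × F}

/-- Rescaling the fiber component by `f` absorbs the positive factor `f²`. -/
lemma quadForm_warpedMetric_equivalent (hp : f p.1 ≠ 0) :
    (quadForm (I.prod I') (warpedMetric I I' gB gF f) p).Equivalent
      ((quadForm I gB p.1).prod (quadForm I' gF p.2)) :=
  ⟨{ toFun := fun v => (tfst p v, f p.1 • tsnd p v)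
     invFun := fun u => tmk p u.1 ((f p.1)⁻¹ • u.2)
     map_add' := fun v w => by simp
     map_smul' := fun c v => by simp [smul_comm (f p.1) c]
     left_inv := fun v => tangent_prod_ext (by simp) (by simp [hp])
     right_inv := fun u => by simp [hp]
     map_app' := fun v => by
      simp [warpedMetric_apply]
      ring }⟩

lemma quadForm_warpedMetric_equivalent_of_eq_zero (hp : f p.1 = 0) :
    (quadForm (I.prod I') (warpedMetric I I' gB gF f) p).Equivalent
      ((quadForm I gB p.1).prod (0 : QuadraticForm ℝ (TangentSpace I' p.2))) :=
  ⟨{ toFun := fun v => (tfst p v, tsnd p v)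
     invFun := fun u => tmk p u.1 u.2
     map_add' := fun v w => by simp
     map_smul' := fun c v => by simp
     left_inv := fun v => tangent_prod_ext (by simp) (by simp)
     right_inv := fun u => by simp
     map_app' := fun v => by simp [warpedMetric_apply, hp] }⟩

/-- Along the slice `{p.1} × F` the base contributes a constant and `f` stays at its nonzero value,
so the signature of `g_F` is constant there too. -/
lemma mem_constSignature_of_warpedMetric
    (h : p ∈ constSignature (I.prod I') (warpedMetric I I' gB gF f)) (hp : f p.1 ≠ 0) :
    p.2 ∈ constSignature I' gF := by
  have hc : Filter.Tendsto (fun x => (p.1, x)) (𝓝 p.2) (𝓝 p) :=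
    (Continuous.prodMk_right p.1).tendsto' _ _ rfl
  filter_upwards [hc.eventually h] with x hx
  have e := quadForm_warpedMetric_equivalent (I := I) (I' := I') (gB := gB) (gF := gF) hp
  have e' := quadForm_warpedMetric_equivalent (I := I) (I' := I') (gB := gB) (gF := gF)
    (p := (p.1, x)) hp
  rw [e.sigPos_eq.trans (sigPos_prod _ _), e'.sigPos_eq.trans (sigPos_prod _ _),
    e.sigNeg_eq.trans (sigNeg_prod _ _), e'.sigNeg_eq.trans (sigNeg_prod _ _)] at hx
  exact ⟨Nat.add_left_cancel hx.1, Nat.add_left_cancel hx.2⟩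

/-- At a zero of the warping function which is in a region of constant signature, the warping
function or the fiber metric is trivial. -/
lemma mvfderiv_mul_eq_zero_of_mem_constSignature (hnd : IsNondegenerate I gB)
    (hB : ∀ (p : B) (v w : TangentSpace I p), gB p v w = gB p w v)
    (hF : ∀ (p : F) (v w : TangentSpace I' p), gF p v w = gF p w v)
    (h : p ∈ constSignature (I.prod I') (warpedMetric I I' gB gF f)) (hp : f p.1 = 0)
    (v : TangentSpace I p.1) (w w' : TangentSpace I' p.2) :
    mvfderiv I f p.1 v * gF p.2 w w' = 0 := by
  by_cases hw : gF p.2 w w' = 0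
  · rw [hw, mul_zero]
  have hc : Filter.Tendsto (fun b => (b, p.2)) (𝓝 p.1) (𝓝 p) :=
    (Continuous.prodMk_left p.2).tendsto' _ _ rfl
  -- At `p` the fiber contributes nothing to the signature, and the base has full rank everywhere.
  -- If `f(b) ≠ 0` for `b` near `p.1`, equality of signatures forces that of `g_F` at `p.2` to be
  -- `(0, 0)`, against `gF p.2 w w' ≠ 0`.
  have hf0 : f =ᶠ[𝓝 p.1] fun _ => 0 := by
    filter_upwards [hc.eventually h] with b hb
    by_contra hb0
    have e := quadForm_warpedMetric_equivalent_of_eq_zero (I := I) (I' := I') (gB := gB)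
      (gF := gF) hp
    have e' := quadForm_warpedMetric_equivalent (I := I) (I' := I') (gB := gB) (gF := gF)
      (p := (b, p.2)) hb0
    rw [e.sigPos_eq.trans (sigPos_prod _ _), e'.sigPos_eq.trans (sigPos_prod _ _),
      e.sigNeg_eq.trans (sigNeg_prod _ _), e'.sigNeg_eq.trans (sigNeg_prod _ _), sigPos_zero,
      sigNeg_zero] at hb
    obtain ⟨h₁, h₂⟩ := hb
    have h₃ := (hnd.sigPos_add_sigNeg hB b).trans (hnd.sigPos_add_sigNeg hB p.1).symm
    dsimp only at h₁ h₂
    refine hw (eq_zero_of_sigPos_sigNeg_eq_zero hF ?_ ?_ w w') <;> omega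
  have : mvfderiv I f p.1 v = 0 := by
    have := dirDeriv_congr (I := I) (X := fun _ => v) (X' := fun _ => v) rfl hf0
    simpa [dirDeriv, mvfderiv] using this
  rw [this, zero_mul]

end WarpedSignature

/-! ### Derivatives of the fiber forms `f g_F(W, ·)` and `f² κ` -/

section WarpedSecond

variable {E : Type*} [NormedAddCommGroup E] [NormedSpace ℝ E] [FiniteDimensional ℝ E]
  {H : Type*} [TopologicalSpace H] {I : ModelWithCorners ℝ E H}
  {E' : Type*} [NormedAddCommGroup E'] [NormedSpace ℝ E'] [FiniteDimensional ℝ E']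
  {H' : Type*} [TopologicalSpace H'] {I' : ModelWithCorners ℝ E' H'}
  {B : Type*} [TopologicalSpace B] [ChartedSpace H B] [IsManifold I ∞ B] [T2Space B]
  {F : Type*} [TopologicalSpace F] [ChartedSpace H' F] [IsManifold I' ∞ F] [T2Space F]
  {gB : BilinField I B} {gF : BilinField I' F} {J₁ : EndField I B} {J₂ : EndField I' F}
  {f : B → ℝ} {V V' : VField I B} {W W' : VField I' F} {p : B × F}
  {Z : VField (I.prod I') (B × F)} {σ : CovField (I.prod I') (B × F)}

lemma dirDeriv_prodLift_mul {h : B → ℝ} {k : F → ℝ} (hh : ContMDiff I 𝓘(ℝ, ℝ) ∞ h)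
    (hk : ContMDiff I' 𝓘(ℝ, ℝ) ∞ k) (p : B × F) :
    dirDeriv (I.prod I') (prodLift V W) (fun q => h q.1 * k q.2) p =
      h p.1 * dirDeriv I' W k p.2 + k p.2 * dirDeriv I V h p.1 := by
  have h₁ : ContMDiff (I.prod I') 𝓘(ℝ, ℝ) ∞ fun q : B × F => h q.1 := hh.comp contMDiff_fst
  have h₂ : ContMDiff (I.prod I') 𝓘(ℝ, ℝ) ∞ fun q : B × F => k q.2 := hk.comp contMDiff_snd
  have := dirDeriv_mul (prodLift V W) h₁ h₂ p
  rwa [dirDeriv_prodLift_fst _ _ hh, dirDeriv_prodLift_snd _ _ hk] at this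

/-- To extend `∇̃_Z σ` it suffices to consider lifts `Z`. -/
lemma IsAlmostProduct.covDerivExtendsAt_of_prodLift {g : BilinField (I.prod I') (B × F)}
    {J : EndField (I.prod I') (B × F)} (hJ : IsAlmostProduct (I.prod I') g J)
    (hlow : ∀ X Y, IsSmoothVF (I.prod I') X → IsSmoothVF (I.prod I') Y → ∀ q,
      ∃ v, apLowerDeriv (I.prod I') g J X Y q = g q v) (hσ : IsLowered (I.prod I') g σ)
    (h : ∀ (V : VField I B) (W : VField I' F), IsSmoothVF I V → IsSmoothVF I' W →
      CovDerivExtendsAt g J (prodLift V W) σ p) (hZ : IsSmoothVF (I.prod I') Z) :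
    CovDerivExtendsAt g J Z σ p :=
  prodLift_induction (P := fun Z => CovDerivExtendsAt g J Z σ p) p
    (fun _ _ hX hY he => hJ.covDerivExtendsAt_congr_field hX hY he)
    (fun _ _ hX hY => hJ.covDerivExtendsAt_add_field hlow hX hY hσ)
    (fun _ _ hh hX => hJ.covDerivExtendsAt_smul_field hlow hX hσ hh) h hZ

/-- To compute `∇̃_Z σ` it suffices to evaluate it on lifts. -/
lemma IsAlmostProduct.covDerivExtendsAt_of_apply_prodLift {g : BilinField (I.prod I') (B × F)}
    {J : EndField (I.prod I') (B × F)} (hJ : IsAlmostProduct (I.prod I') g J)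
    (hlow : ∀ X Y, IsSmoothVF (I.prod I') X → IsSmoothVF (I.prod I') Y → ∀ q,
      ∃ v, apLowerDeriv (I.prod I') g J X Y q = g q v) (hZ : IsSmoothVF (I.prod I') Z)
    (hσ : IsLowered (I.prod I') g σ) {η : CovField (I.prod I') (B × F)}
    (hη : IsLowered (I.prod I') g η)
    (h : ∀ (V : VField I B) (W : VField I' F), IsSmoothVF I V → IsSmoothVF I' W →
      ∀ q ∈ constSignature (I.prod I') g,
        η q (prodLift V W q) = apCovDeriv (I.prod I') g J Z σ (prodLift V W) q) (p : B × F) :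
    CovDerivExtendsAt g J Z σ p := by
  refine ⟨η, hη.1, Filter.Eventually.of_forall fun q => ⟨hη.2 q, fun hq T hT => ?_⟩⟩
  obtain ⟨V, hV, hv₁⟩ := exists_smoothVF_eq (I := I) q.1 (tfst q (T q))
  obtain ⟨W, hW, hv₂⟩ := exists_smoothVF_eq (I := I') q.2 (tsnd q (T q))
  have hv : T q = prodLift V W q := tangent_prod_ext hv₁.symm hv₂.symm
  rw [hJ.apCovDeriv_congr_field hlow hZ hσ.1 hσ.2 hT (isSmoothVF_prodLift hV hW) hv, hv,
    h V W hV hW q hq]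

lemma isLowered_smul_sndForm (hf : ContMDiff I 𝓘(ℝ, ℝ) ∞ f) {α : CovField I' F}
    (hα : IsLowered I' gF α) :
    IsLowered (I.prod I') (warpedMetric I I' gB gF f) ((fun p : B × F => f p.1) • sndForm α) :=
  ⟨(isSmoothOneForm_sndForm hα.1).smul (hf.comp contMDiff_fst),
    fun q => lowered_smul_sndForm (hα.2 q.2)⟩

lemma IsLowered.add {E : Type*} [NormedAddCommGroup E] [NormedSpace ℝ E] [FiniteDimensional ℝ E]
    {H : Type*} [TopologicalSpace H] {I : ModelWithCorners ℝ E H} {M : Type*} [TopologicalSpace M]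
    [ChartedSpace H M] [IsManifold I ∞ M] [T2Space M] {g : BilinField I M} {α τ : CovField I M}
    (hα : IsLowered I g α) (hτ : IsLowered I g τ) : IsLowered I g (α + τ) :=
  ⟨hα.1.add hτ.1, fun q => lowered_add (hα.2 q) (hτ.2 q)⟩

lemma IsLowered.smul {E : Type*} [NormedAddCommGroup E] [NormedSpace ℝ E] [FiniteDimensional ℝ E]
    {H : Type*} [TopologicalSpace H] {I : ModelWithCorners ℝ E H} {M : Type*} [TopologicalSpace M]
    [ChartedSpace H M] [IsManifold I ∞ M] [T2Space M] {g : BilinField I M} {α : CovField I M}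
    {h : M → ℝ} (hα : IsLowered I g α) (hh : ContMDiff I 𝓘(ℝ, ℝ) ∞ h) :
    IsLowered I g (h • α) :=
  ⟨hα.1.smul hh, fun q => lowered_smul (h q) (hα.2 q)⟩

lemma IsSingularMetric.isLowered_lowering {E : Type*} [NormedAddCommGroup E] [NormedSpace ℝ E]
    [FiniteDimensional ℝ E] {H : Type*} [TopologicalSpace H] {I : ModelWithCorners ℝ E H}
    {M : Type*} [TopologicalSpace M] [ChartedSpace H M] [IsManifold I ∞ M] [T2Space M]
    {g : BilinField I M} {Y : VField I M} (hg : IsSingularMetric I g) (hY : IsSmoothVF I Y) :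
    IsLowered I g (lowering g Y) :=
  ⟨hg.isSmoothOneForm_lowering hY, fun q => ⟨Y q, rfl⟩⟩

lemma isLowered_gradForm (hB : IsAlmostProduct I gB J₁) (hnd : IsNondegenerate I gB)
    (hf : ContMDiff I 𝓘(ℝ, ℝ) ∞ f) {b c : F → ℝ} (hb : ContMDiff I' 𝓘(ℝ, ℝ) ∞ b)
    (hc : ContMDiff I' 𝓘(ℝ, ℝ) ∞ c) :
    IsLowered (I.prod I') (warpedMetric I I' gB gF f) (gradForm f J₁ b c) :=
  ⟨hB.isSmoothOneForm_gradForm hf hb hc, fun _ => hnd.lowered_gradForm _ _⟩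

/-- The value of `∇̃♭` on a vector tangent to the fibers. -/
lemma apLowerDeriv_prodLift_tmk_zero (hB : IsAlmostProduct I gB J₁) (hF : IsAlmostProduct I' gF J₂)
    (hf : ContMDiff I 𝓘(ℝ, ℝ) ∞ f) (hV : IsSmoothVF I V) (hV' : IsSmoothVF I V')
    (hW : IsSmoothVF I' W) (hW' : IsSmoothVF I' W') (u : TangentSpace I' p.2) :
    apLowerDeriv (I.prod I') (warpedMetric I I' gB gF f) (prodStructure I I' J₁ J₂) (prodLift V W)
      (prodLift V' W') p (tmk p 0 u) =
      f p.1 ^ 2 * apLowerDeriv I' gF J₂ W W' p.2 u +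
      dirDeriv I V f p.1 * (f p.1 * gF p.2 (W' p.2) u) +
      2⁻¹ * mvfderiv I f p.1 (V' p.1) * (f p.1 * gF p.2 (W p.2) u) +
      2⁻¹ * mvfderiv I f p.1 (J₁ p.1 (V' p.1)) * (f p.1 * gF p.2 (J₂ p.2 (W p.2)) u) := by
  rw [apLowerDeriv_prodLift hB hF hf hV hV' hW hW']
  simp [lowering]

/-- The derivative of the `1`-form `f g_F(W, ·)`. -/
lemma covDerivExtendsAt_smul_sndForm_lowering (hB : IsAlmostProduct I gB J₁)
    (hnd : IsNondegenerate I gB) (hF : IsAPSemiRegular I' gF J₂) (hf : ContMDiff I 𝓘(ℝ, ℝ) ∞ f)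
    (hW : IsSmoothVF I' W) (hZ : IsSmoothVF (I.prod I') Z) (p : B × F) :
    CovDerivExtendsAt (warpedMetric I I' gB gF f) (prodStructure I I' J₁ J₂) Z
      ((fun p : B × F => f p.1) • sndForm (lowering gF W)) p := by
  have hJF := hF.almostProduct
  have hJ := isAlmostProduct_warpedMetric hB hJF hf
  have hlow := lowered_apLowerDeriv_warpedMetric hB hnd hJF
    (fun W W' hW hW' => (hF.lower W W' hW hW').2) hf
  have hσ := isLowered_smul_sndForm (I := I) (gB := gB) hf (hJF.metric.isLowered_lowering hW)
  refine hJ.covDerivExtendsAt_of_prodLift hlow hσ (fun V₁ W₁ hV₁ hW₁ => ?_) hZ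
  have hZ := isSmoothVF_prodLift hV₁ hW₁
  -- The extension is `f ∇̃♭_{W₁} W` minus a `gradForm`: the two terms `V₁(f) g_F(W, W₂)` cancel,
  -- and the contributions of `V₂(f)` and `df(J₁ V₂)` form the gradient part.
  have hη := (isLowered_smul_sndForm (I := I) (gB := gB) hf (hF.lower W₁ W hW₁ hW)).add
    ((isLowered_gradForm (gF := gF) hB hnd hf (hJF.metric.contMDiff_pairing hW₁ hW)
      (hJF.metric.contMDiff_pairing (hJF.smoothVF hW₁) hW)).smul
      (h := fun _ => -1) contMDiff_const)
  refine hJ.covDerivExtendsAt_of_apply_prodLift hlow hZ hσ hη (fun V₂ W₂ hV₂ hW₂ q hq => ?_) p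
  have hT := isSmoothVF_prodLift hV₂ hW₂
  have hd : dirDeriv (I.prod I') (prodLift V₁ W₁) (fun q =>
      ((fun p : B × F => f p.1) • sndForm (lowering gF W)) q (prodLift V₂ W₂ q)) q =
      f q.1 * dirDeriv I' W₁ (pairing I' gF W W₂) q.2 +
        pairing I' gF W W₂ q.2 * dirDeriv I V₁ f q.1 :=
    dirDeriv_prodLift_mul hf (hJF.metric.contMDiff_pairing hW hW₂) q
  by_cases h0 : f q.1 = 0
  -- At a zero of `f` the derivative is `V₁(f) g_F(W, W₂)` and the extension is minus the gradient
  -- part. Neither carries a factor `f`; both vanish because `df ⊗ g_F = 0` here. This is where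
  -- constant signature is indispensable.
  · have hz := mvfderiv_mul_eq_zero_of_mem_constSignature hnd hB.metric.symm hJF.metric.symm hq h0
    obtain ⟨v, hv⟩ := hlow _ _ hZ hT q
    have z₁ := hz (V₁ q.1) (W q.2) (W₂ q.2)
    have z₂ := hz (V₂ q.1) (W₁ q.2) (W q.2)
    have z₃ := hz (J₁ q.1 (V₂ q.1)) (J₂ q.2 (W₁ q.2)) (W q.2)
    rw [hJ.apCovDeriv_eq hv (hσ.2 q), hd]
    simp [h0, pairing, dirDeriv]
    linear_combination -2⁻¹ * z₂ - 2⁻¹ * z₃ - z₁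
  · have hw : ((fun p : B × F => f p.1) • sndForm (lowering gF W)) q =
        warpedMetric I I' gB gF f q (tmk q 0 ((f q.1)⁻¹ • W q.2)) := by
      refine warpedMetric_tmk_zero_left ?_
      rw [map_smul, smul_smul, pow_two, mul_assoc, mul_inv_cancel₀ h0, mul_one]
      rfl
    rw [apCovDeriv, hJ.metric.coInner_eq_apply_left (hlow _ _ hZ hT q) hw,
      apLowerDeriv_prodLift_tmk_zero hB hJF hf hV₁ hV₂ hW₁ hW₂, hd,
      ← hJF.apKoszul_add_swap (J := J₂), ← hJF.apLowerDeriv_apply hW₁ hW hW₂,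
      ← hJF.apLowerDeriv_apply hW₁ hW₂ hW]
    have hs := hJF.metric.symm q.2 (W₂ q.2) (W q.2)
    simp [pairing, hs]
    field_simp
    ring

/-- The derivative of the `1`-form `f² κ` for a `1`-form `κ` on the fiber. -/
lemma covDerivExtendsAt_sq_smul_sndForm (hB : IsAlmostProduct I gB J₁)
    (hnd : IsNondegenerate I gB) (hF : IsAPSemiRegular I' gF J₂) (hf : ContMDiff I 𝓘(ℝ, ℝ) ∞ f)
    {κ : CovField I' F} (hκ : IsLowered I' gF κ)
    (hκ' : ∀ W₁, IsSmoothVF I' W₁ → ExtendsToLowered I' gF (apCovDeriv I' gF J₂ W₁ κ))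
    (hZ : IsSmoothVF (I.prod I') Z) (p : B × F) :
    CovDerivExtendsAt (warpedMetric I I' gB gF f) (prodStructure I I' J₁ J₂) Z
      ((fun p : B × F => f p.1) • (fun p : B × F => f p.1) • sndForm κ) p := by
  have hJF := hF.almostProduct
  have hJ := isAlmostProduct_warpedMetric hB hJF hf
  have hlow := lowered_apLowerDeriv_warpedMetric hB hnd hJF
    (fun W W' hW hW' => (hF.lower W W' hW hW').2) hf
  have hf' : ContMDiff (I.prod I') 𝓘(ℝ, ℝ) ∞ fun p : B × F => f p.1 := hf.comp contMDiff_fst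
  have hfκ := isLowered_smul_sndForm (I := I) (gB := gB) hf hκ
  have hσ := hfκ.smul hf'
  refine hJ.covDerivExtendsAt_of_prodLift hlow hσ (fun V₁ W₁ hV₁ hW₁ => ?_) hZ
  have hZ := isSmoothVF_prodLift hV₁ hW₁
  obtain ⟨ηF, hηF, hηF'⟩ := hκ' W₁ hW₁
  -- The extension is `V₁(f) f κ + f² η_F - f · gradForm`, where `η_F` extends the fiber derivative
  -- of `κ`. The product rule gives `2 f V₁(f) κ`, and `∇̃♭` removes one of the two copies.
  have hη := ((hfκ.smul (h := fun p : B × F => dirDeriv I V₁ f p.1)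
      ((contMDiff_dirDeriv hV₁ hf).comp contMDiff_fst)).add
    ((isLowered_smul_sndForm (I := I) (gB := gB) hf hηF).smul hf')).add
    ((isLowered_gradForm (gF := gF) hB hnd hf (hκ.1.apply hW₁)
      (hκ.1.apply (hJF.smoothVF hW₁))).smul (h := fun p : B × F => - f p.1) hf'.neg)
  refine hJ.covDerivExtendsAt_of_apply_prodLift hlow hZ hσ hη (fun V₂ W₂ hV₂ hW₂ q hq => ?_) p
  have hT := isSmoothVF_prodLift hV₂ hW₂
  have hd : dirDeriv (I.prod I') (prodLift V₁ W₁) (fun q =>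
      ((fun p : B × F => f p.1) • (fun p : B × F => f p.1) • sndForm κ) q (prodLift V₂ W₂ q)) q =
      (f q.1 * f q.1) * dirDeriv I' W₁ (fun x => κ x (W₂ x)) q.2 +
        κ q.2 (W₂ q.2) * (2 * f q.1 * dirDeriv I V₁ f q.1) := by
    have h := dirDeriv_prodLift_mul (V := V₁) (W := W₁) (h := f * f) (hf.mul hf)
      (hκ.1.apply hW₂) q
    rw [dirDeriv_mul _ hf hf, ← two_mul, ← mul_assoc 2] at h
    rw [← Pi.mul_apply f f, ← h]
    refine dirDeriv_congr rfl (Filter.Eventually.of_forall fun x => ?_)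
    simp [mul_assoc]
  by_cases h0 : f q.1 = 0
  -- Here every term retains a factor `f`, so at its zeros both sides are zero.
  · obtain ⟨v, hv⟩ := hlow _ _ hZ hT q
    rw [hJ.apCovDeriv_eq hv (hσ.2 q), hd]
    simp [h0]
  · obtain ⟨u, hu⟩ := hκ.2 q.2
    have hw : ((fun p : B × F => f p.1) • (fun p : B × F => f p.1) • sndForm κ) q =
        warpedMetric I I' gB gF f q (tmk q 0 u) := by
      ext v
      simp [warpedMetric_apply, hu]
      ring
    -- The form `η_F` is controlled only on the regions of constant signature of the fiber, which
    -- contain `q.2` because `f ≠ 0`.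
    have hF' := hηF' W₂ hW₂ q.2 (mem_constSignature_of_warpedMetric hq h0)
    rw [apCovDeriv, hJF.metric.coInner_eq_apply_left ((hF.lower W₁ W₂ hW₁ hW₂).2 q.2) hu] at hF'
    rw [apCovDeriv, hJ.metric.coInner_eq_apply_left (hlow _ _ hZ hT q) hw,
      apLowerDeriv_prodLift_tmk_zero hB hJF hf hV₁ hV₂ hW₁ hW₂, hd]
    have hs : ∀ x, gF q.2 x u = κ q.2 x := fun x => by rw [hu, hJF.metric.symm]
    simp [hF', hs]
    ring

end WarpedSecond

/-! ### Semi-regularity of the warped product -/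

section WarpedSemiRegular

variable {E : Type*} [NormedAddCommGroup E] [NormedSpace ℝ E] [FiniteDimensional ℝ E]
  {H : Type*} [TopologicalSpace H] {I : ModelWithCorners ℝ E H}
  {E' : Type*} [NormedAddCommGroup E'] [NormedSpace ℝ E'] [FiniteDimensional ℝ E']
  {H' : Type*} [TopologicalSpace H'] {I' : ModelWithCorners ℝ E' H'}
  {B : Type*} [TopologicalSpace B] [ChartedSpace H B] [IsManifold I ∞ B] [T2Space B]
  {F : Type*} [TopologicalSpace F] [ChartedSpace H' F] [IsManifold I' ∞ F] [T2Space F]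
  {gB : BilinField I B} {gF : BilinField I' F} {J₁ : EndField I B} {J₂ : EndField I' F}
  {f : B → ℝ} {V V' : VField I B} {W W' : VField I' F} {p : B × F}
  {X Y Z : VField (I.prod I') (B × F)}

lemma isLowered_fstForm (hnd : IsNondegenerate I gB) {β : CovField I B}
    (hβ : IsSmoothOneForm I β) :
    IsLowered (I.prod I') (warpedMetric I I' gB gF f) (fstForm β) :=
  ⟨isSmoothOneForm_fstForm hβ, fun _ => hnd.lowered_fstForm _⟩

/-- The derivative of the pullback of a `1`-form on the base. -/
lemma covDerivExtendsAt_fstForm (hB : IsAlmostProduct I gB J₁)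
    (hnd : IsNondegenerate I gB) (hF : IsAPSemiRegular I' gF J₂) (hf : ContMDiff I 𝓘(ℝ, ℝ) ∞ f)
    {β : CovField I B} (hβ : IsSmoothOneForm I β) (hZ : IsSmoothVF (I.prod I') Z) (p : B × F) :
    CovDerivExtendsAt (warpedMetric I I' gB gF f) (prodStructure I I' J₁ J₂) Z (fstForm β) p := by
  obtain ⟨U, hU, hβU⟩ := hnd.exists_lowering_eq hB.metric hβ
  -- The field raising `β` on the base, lifted with zero fiber part, raises the pullback for every
  -- `f`, so no division by `f` occurs.
  have he : fstForm β = lowering (warpedMetric I I' gB gF f) (prodLift U (0 : VField I' F)) :=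
    funext fun q => warpedMetric_tmk_zero_right (congrFun hβU q.1)
  rw [he]
  exact (isAlmostProduct_warpedMetric hB hF.almostProduct hf).covDerivExtendsAt_lowering
    (lowered_apLowerDeriv_warpedMetric hB hnd hF.almostProduct
      (fun W W' hW hW' => (hF.lower W W' hW hW').2) hf) hZ
    (isSmoothVF_prodLift hU isSmoothVF_zero) p

/-- The second almost product derivatives of a warped product extend for lifts. -/
lemma covDerivExtendsAt_apLowerDeriv_prodLift (hB : IsAlmostProduct I gB J₁)
    (hnd : IsNondegenerate I gB) (hF : IsAPSemiRegular I' gF J₂) (hf : ContMDiff I 𝓘(ℝ, ℝ) ∞ f)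
    (hV : IsSmoothVF I V) (hV' : IsSmoothVF I V') (hW : IsSmoothVF I' W) (hW' : IsSmoothVF I' W')
    (hZ : IsSmoothVF (I.prod I') Z) (p : B × F) :
    CovDerivExtendsAt (warpedMetric I I' gB gF f) (prodStructure I I' J₁ J₂) Z
      (apLowerDeriv (I.prod I') (warpedMetric I I' gB gF f) (prodStructure I I' J₁ J₂)
        (prodLift V W) (prodLift V' W')) p := by
  have hJF := hF.almostProduct
  have hJ := isAlmostProduct_warpedMetric hB hJF hf
  have hlow := lowered_apLowerDeriv_warpedMetric hB hnd hJF
    (fun W W' hW hW' => (hF.lower W W' hW hW').2) hf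
  have hf' : ContMDiff (I.prod I') 𝓘(ℝ, ℝ) ∞ fun p : B × F => f p.1 := hf.comp contMDiff_fst
  have hdf := isSmoothOneForm_dForm hf
  let grad : CovField (I.prod I') (B × F) := gradForm f J₁ (pairing I' gF W W')
    (pairing I' gF W fun q => J₂ q (W' q))
  have he : apLowerDeriv (I.prod I') (warpedMetric I I' gB gF f) (prodStructure I I' J₁ J₂)
        (prodLift V W) (prodLift V' W') =
      fstForm (apLowerDeriv I gB J₁ V V') +
      (fun p : B × F => f p.1) • (fun p : B × F => f p.1) •
        sndForm (apLowerDeriv I' gF J₂ W W') +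
      (fun p : B × F => dirDeriv I V f p.1) • (fun p : B × F => f p.1) •
        sndForm (lowering gF W') +
      (fun p : B × F => 2⁻¹ * dirDeriv I V' f p.1) • (fun p : B × F => f p.1) •
        sndForm (lowering gF W) +
      (fun p : B × F => 2⁻¹ * dirDeriv I (fun q => J₁ q (V' q)) f p.1) •
        (fun p : B × F => f p.1) • sndForm (lowering gF fun q => J₂ q (W q)) +
      (fun p : B × F => - f p.1) • grad := by
    funext q
    rw [apLowerDeriv_prodLift hB hJF hf hV hV' hW hW', pow_two, mul_smul]
    rfl
  have hθ : ∀ {W : VField I' F}, IsSmoothVF I' W → IsLowered (I.prod I')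
      (warpedMetric I I' gB gF f) ((fun p : B × F => f p.1) • sndForm (lowering gF W)) :=
    fun hW => isLowered_smul_sndForm hf (hJF.metric.isLowered_lowering hW)
  have hθd : ∀ {W : VField I' F}, IsSmoothVF I' W → CovDerivExtendsAt
      (warpedMetric I I' gB gF f) (prodStructure I I' J₁ J₂) Z
      ((fun p : B × F => f p.1) • sndForm (lowering gF W)) p :=
    fun hW => covDerivExtendsAt_smul_sndForm_lowering hB hnd hF hf hW hZ p
  have c₁ : ContMDiff (I.prod I') 𝓘(ℝ, ℝ) ∞ fun p : B × F => dirDeriv I V f p.1 :=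
    (contMDiff_dirDeriv hV hf).comp contMDiff_fst
  have c₂ : ∀ {V' : VField I B}, IsSmoothVF I V' →
      ContMDiff (I.prod I') 𝓘(ℝ, ℝ) ∞ fun p : B × F => 2⁻¹ * dirDeriv I V' f p.1 :=
    fun hV' => contMDiff_const.mul ((contMDiff_dirDeriv hV' hf).comp contMDiff_fst)
  have c₃ : ∀ {b : F → ℝ}, ContMDiff I' 𝓘(ℝ, ℝ) ∞ b →
      ContMDiff (I.prod I') 𝓘(ℝ, ℝ) ∞ fun p : B × F => 2⁻¹ * b p.2 :=
    fun hb => contMDiff_const.mul (hb.comp contMDiff_snd)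
  have hb := hJF.metric.contMDiff_pairing hW hW'
  have hc := hJF.metric.contMDiff_pairing hW (hJF.smoothVF hW')
  have hdJ := hB.isSmoothOneForm_compEnd hdf
  have hl₁ := isLowered_fstForm (I' := I') (gF := gF) (f := f) hnd
    (hB.isSmoothOneForm_apLowerDeriv hV hV')
  have hκ := hF.lower W W' hW hW'
  have hl₂ := (isLowered_smul_sndForm (I := I) (gB := gB) hf hκ).smul hf'
  have hl₃ := (hθ hW').smul c₁
  have hl₄ := (hθ hW).smul (c₂ hV')
  have hl₅ := (hθ (hJF.smoothVF hW)).smul (c₂ (hB.smoothVF hV'))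
  have hl₆ : IsLowered (I.prod I') (warpedMetric I I' gB gF f) grad :=
    isLowered_gradForm hB hnd hf hb hc
  have hgrad : CovDerivExtendsAt (warpedMetric I I' gB gF f) (prodStructure I I' J₁ J₂) Z
      grad p :=
    hJ.covDerivExtendsAt_add hlow hZ ((isLowered_fstForm hnd hdf).smul (c₃ hb))
      ((isLowered_fstForm hnd hdJ).smul (c₃ hc))
      (hJ.covDerivExtendsAt_smul hlow hZ (isLowered_fstForm hnd hdf) (c₃ hb)
        (covDerivExtendsAt_fstForm hB hnd hF hf hdf hZ p))
      (hJ.covDerivExtendsAt_smul hlow hZ (isLowered_fstForm hnd hdJ) (c₃ hc)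
        (covDerivExtendsAt_fstForm hB hnd hF hf hdJ hZ p))
  have hd₁ := covDerivExtendsAt_fstForm hB hnd hF hf (hB.isSmoothOneForm_apLowerDeriv hV hV') hZ p
  have hd₂ := covDerivExtendsAt_sq_smul_sndForm hB hnd hF hf hκ
    (fun W₁ hW₁ => hF.second W W' W₁ hW hW' hW₁) hZ p
  have hd₃ := hJ.covDerivExtendsAt_smul hlow hZ (hθ hW') c₁ (hθd hW')
  have hd₄ := hJ.covDerivExtendsAt_smul hlow hZ (hθ hW) (c₂ hV') (hθd hW)
  have hd₅ := hJ.covDerivExtendsAt_smul hlow hZ (hθ (hJF.smoothVF hW)) (c₂ (hB.smoothVF hV'))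
    (hθd (hJF.smoothVF hW))
  have hd₆ := hJ.covDerivExtendsAt_smul hlow hZ hl₆ hf'.neg hgrad
  rw [he]
  have a₂ := hJ.covDerivExtendsAt_add hlow hZ hl₁ hl₂ hd₁ hd₂
  have a₃ := hJ.covDerivExtendsAt_add hlow hZ (hl₁.add hl₂) hl₃ a₂ hd₃
  have a₄ := hJ.covDerivExtendsAt_add hlow hZ ((hl₁.add hl₂).add hl₃) hl₄ a₃ hd₄
  have a₅ := hJ.covDerivExtendsAt_add hlow hZ (((hl₁.add hl₂).add hl₃).add hl₄) hl₅ a₄ hd₅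
  exact hJ.covDerivExtendsAt_add hlow hZ ((((hl₁.add hl₂).add hl₃).add hl₄).add hl₅)
    (hl₆.smul hf'.neg) a₅ hd₆

/-- The second almost product derivatives of a warped product extend. -/
lemma covDerivExtendsAt_apLowerDeriv (hB : IsAlmostProduct I gB J₁)
    (hnd : IsNondegenerate I gB) (hF : IsAPSemiRegular I' gF J₂) (hf : ContMDiff I 𝓘(ℝ, ℝ) ∞ f)
    (hX : IsSmoothVF (I.prod I') X) (hY : IsSmoothVF (I.prod I') Y)
    (hZ : IsSmoothVF (I.prod I') Z) (p : B × F) :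
    CovDerivExtendsAt (warpedMetric I I' gB gF f) (prodStructure I I' J₁ J₂) Z
      (apLowerDeriv (I.prod I') (warpedMetric I I' gB gF f) (prodStructure I I' J₁ J₂) X Y) p := by
  have hJF := hF.almostProduct
  have hJ := isAlmostProduct_warpedMetric hB hJF hf
  have hlow := lowered_apLowerDeriv_warpedMetric hB hnd hJF
    (fun W W' hW hW' => (hF.lower W W' hW hW').2) hf
  have hl : ∀ {X Y}, IsSmoothVF (I.prod I') X → IsSmoothVF (I.prod I') Y →
      IsLowered (I.prod I') (warpedMetric I I' gB gF f) (apLowerDeriv (I.prod I')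
        (warpedMetric I I' gB gF f) (prodStructure I I' J₁ J₂) X Y) :=
    fun hX hY => ⟨hJ.isSmoothOneForm_apLowerDeriv hX hY, hlow _ _ hX hY⟩
  refine prodLift_induction (P := fun X => CovDerivExtendsAt (warpedMetric I I' gB gF f)
    (prodStructure I I' J₁ J₂) Z (apLowerDeriv (I.prod I') (warpedMetric I I' gB gF f)
      (prodStructure I I' J₁ J₂) X Y) p) p ?_ ?_ ?_ ?_ hX
  · intro X X' hX hX' he h
    -- The form is differentiated once more, so it has to agree on a neighborhood of `p` and not
    -- only at `p`.
    exact IsAlmostProduct.covDerivExtendsAt_congr (he.eventually_nhds.mono fun q hq =>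
      hJ.apLowerDeriv_congr hX hX' hY hY hq (Filter.Eventually.of_forall fun _ => rfl)) h
  · intro X X' hX hX' h h'
    rw [hJ.apLowerDeriv_add_first hX hX' hY]
    exact hJ.covDerivExtendsAt_add hlow hZ (hl hX hY) (hl hX' hY) h h'
  · intro h X hh hX hP
    rw [hJ.apLowerDeriv_smul_first hX hY hh]
    exact hJ.covDerivExtendsAt_smul hlow hZ (hl hX hY) hh hP
  intro V W hV hW
  have hX := isSmoothVF_prodLift hV hW
  refine prodLift_induction (P := fun Y => CovDerivExtendsAt (warpedMetric I I' gB gF f)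
    (prodStructure I I' J₁ J₂) Z (apLowerDeriv (I.prod I') (warpedMetric I I' gB gF f)
      (prodStructure I I' J₁ J₂) (prodLift V W) Y) p) p ?_ ?_ ?_ ?_ hY
  · intro Y Y' hY hY' he h
    exact IsAlmostProduct.covDerivExtendsAt_congr (he.eventually_nhds.mono fun q hq =>
      hJ.apLowerDeriv_congr hX hX hY hY' (Filter.Eventually.of_forall fun _ => rfl) hq) h
  · intro Y Y' hY hY' h h'
    rw [hJ.apLowerDeriv_add_second hX hY hY']
    exact hJ.covDerivExtendsAt_add hlow hZ (hl hX hY) (hl hX hY') h h'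
  · intro h Y hh hY hP
    have hYl := hJ.metric.isLowered_lowering hY
    have hh' := contMDiff_dirDeriv hX hh
    rw [hJ.apLowerDeriv_smul_second hX hY hh]
    -- The Leibniz term `X(h) Y♭` is harmless, as `∇̃_Z Y♭ = ∇̃♭_Z Y` is already lowered.
    exact hJ.covDerivExtendsAt_add hlow hZ ((hl hX hY).smul hh) (hYl.smul hh')
      (hJ.covDerivExtendsAt_smul hlow hZ (hl hX hY) hh hP)
      (hJ.covDerivExtendsAt_smul hlow hZ hYl hh' (hJ.covDerivExtendsAt_lowering hlow hZ hY p))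
  intro V' W' hV' hW'
  exact covDerivExtendsAt_apLowerDeriv_prodLift hB hnd hF hf hV hV' hW hW' hZ p

/-- A warped product with non-degenerate base and almost product semi-regular fiber is almost
product semi-regular. -/
theorem isAPSemiRegular_warpedMetric [SigmaCompactSpace (B × F)] (hB : IsAlmostProduct I gB J₁)
    (hnd : IsNondegenerate I gB) (hF : IsAPSemiRegular I' gF J₂)
    (hf : ContMDiff I 𝓘(ℝ, ℝ) ∞ f) :
    IsAPSemiRegular (I.prod I') (warpedMetric I I' gB gF f) (prodStructure I I' J₁ J₂) where
  almostProduct := isAlmostProduct_warpedMetric hB hF.almostProduct hf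
  lower X Y hX hY := ⟨(isAlmostProduct_warpedMetric hB hF.almostProduct
    hf).isSmoothOneForm_apLowerDeriv hX hY, lowered_apLowerDeriv_warpedMetric hB hnd
      hF.almostProduct (fun W W' hW hW' => (hF.lower W W' hW hW').2) hf X Y hX hY⟩
  second _ _ _ hX hY hZ := extendsToLowered_of_covDerivExtendsAt fun p =>
    covDerivExtendsAt_apLowerDeriv hB hnd hF hf hX hY hZ p

end WarpedSemiRegular

/-! ### Contractions of Koszul forms, and the case `J = id` -/

section Consequences

variable {E : Type*} [NormedAddCommGroup E] [NormedSpace ℝ E] [FiniteDimensional ℝ E]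
  {H : Type*} [TopologicalSpace H] {I : ModelWithCorners ℝ E H}
  {M : Type*} [TopologicalSpace M] [ChartedSpace H M] [IsManifold I ∞ M] [T2Space M]
  {g : BilinField I M} {J : EndField I M} {X Y Z T : VField I M}

/-- On an almost product semi-regular manifold the contractions of almost product Koszul forms
extend to smooth functions. -/
theorem IsAPSemiRegular.exists_contMDiff_eq_apContraction (h : IsAPSemiRegular I g J)
    (hX : IsSmoothVF I X) (hY : IsSmoothVF I Y) (hZ : IsSmoothVF I Z) (hT : IsSmoothVF I T) :
    ∃ k : M → ℝ, ContMDiff I 𝓘(ℝ, ℝ) ∞ k ∧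
      ∀ p ∈ constSignature I g, k p = apContraction I g J X Y Z T p := by
  obtain ⟨η, hη, hη'⟩ := h.second X Y Z hX hY hZ
  -- The definition of `∇̃_Z` read backwards: `⟪∇̃♭_X Y, ∇̃♭_Z T⟫ = Z((∇̃♭_X Y)(T)) - (∇̃_Z ∇̃♭_X
  -- Y)(T)`, with the last term replaced by its smooth extension.
  refine ⟨_, (contMDiff_dirDeriv hZ ((h.lower X Y hX hY).1.apply hT)).sub (hη.1.apply hT),
    fun p hp => ?_⟩
  rw [hη' T hT p hp, apCovDeriv, sub_sub_cancel, apContraction,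
    h.almostProduct.metric.coInner_comm ((h.lower Z T hZ hT).2 p) ((h.lower X Y hX hY).2 p)]

/-- Every singular metric is compatible with the identity. -/
lemma IsSingularMetric.isAlmostProduct_id (hg : IsSingularMetric I g) :
    IsAlmostProduct I g fun _ => ContinuousLinearMap.id ℝ _ where
  metric := hg
  smooth := contMDiff_endField_iff.2 fun _ hX => hX
  involutive _ _ := rfl
  isometric _ _ _ := rfl

/-- For `J = id` the average defining `K̃` is `K` itself, so radical-stationarity is covered by the
almost product results. -/
lemma apLowerDeriv_id :
    apLowerDeriv I g (fun _ => ContinuousLinearMap.id ℝ _) X Y = lowerDeriv I g X Y := by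
  have : ∀ Z p, apKoszul I g (fun _ => ContinuousLinearMap.id ℝ _) X Y Z p =
      koszul I g X Y Z p := fun Z p => by
    simp [apKoszul]
    ring
  funext p
  exact congrArg (toCovector I p) (funext fun Z => this Z p)

end Consequences

/-! ### Radical-stationarity of the warped product -/

section WarpedRadicalStationary

variable {E : Type*} [NormedAddCommGroup E] [NormedSpace ℝ E] [FiniteDimensional ℝ E]
  {H : Type*} [TopologicalSpace H] {I : ModelWithCorners ℝ E H}
  {E' : Type*} [NormedAddCommGroup E'] [NormedSpace ℝ E'] [FiniteDimensional ℝ E']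
  {H' : Type*} [TopologicalSpace H'] {I' : ModelWithCorners ℝ E' H'}
  {B : Type*} [TopologicalSpace B] [ChartedSpace H B] [IsManifold I ∞ B] [T2Space B]
  {F : Type*} [TopologicalSpace F] [ChartedSpace H' F] [IsManifold I' ∞ F] [T2Space F]
  {gB : BilinField I B} {gF : BilinField I' F} {f : B → ℝ}

/-- A warped product with non-degenerate base and radical-stationary fiber is
radical-stationary. -/
theorem isRadicalStationary_warpedMetric (hB : IsSingularMetric I gB)
    (hnd : IsNondegenerate I gB) (hF : IsSingularMetric I' gF) (hF' : IsRadicalStationary I' gF)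
    (hf : ContMDiff I 𝓘(ℝ, ℝ) ∞ f) :
    IsRadicalStationary (I.prod I') (warpedMetric I I' gB gF f) := by
  intro X Y hX hY
  have hB' := hB.isAlmostProduct_id
  have hJF := hF.isAlmostProduct_id
  have hid : prodStructure I I' (fun _ : B => ContinuousLinearMap.id ℝ _)
      (fun _ : F => ContinuousLinearMap.id ℝ _) = fun _ => ContinuousLinearMap.id ℝ _ := rfl
  have h₁ := (isAlmostProduct_warpedMetric hB' hJF hf).isSmoothOneForm_apLowerDeriv hX hY
  have h₂ := lowered_apLowerDeriv_warpedMetric hB' hnd hJF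
    (fun W W' hW hW' => by
      rw [apLowerDeriv_id]
      exact (hF' W W' hW hW').2) hf X Y hX hY
  rw [hid, apLowerDeriv_id] at h₁
  simp only [hid, apLowerDeriv_id] at h₂
  exact ⟨h₁, h₂⟩

end WarpedRadicalStationary

end SingularGeometry

end

open SingularGeometry in
theorem theorem4p16 {m n : ℕ}
    {B : Type*} [TopologicalSpace B] [T2Space B] [SecondCountableTopology B]
    [ChartedSpace (EuclideanSpace ℝ (Fin m)) B] [IsManifold (𝓡 m) ∞ B]
    {F : Type*} [TopologicalSpace F] [T2Space F] [SecondCountableTopology F]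
    [ChartedSpace (EuclideanSpace ℝ (Fin n)) F] [IsManifold (𝓡 n) ∞ F]
    (gB : BilinField (𝓡 m) B) (J₁ : EndField (𝓡 m) B)
    (hB : IsAlmostProduct (𝓡 m) gB J₁) (hnd : IsNondegenerate (𝓡 m) gB)
    (gF : BilinField (𝓡 n) F) (J₂ : EndField (𝓡 n) F)
    (hF : IsAPSemiRegular (𝓡 n) gF J₂)
    (f : B → ℝ) (hf : ContMDiff (𝓡 m) 𝓘(ℝ, ℝ) ∞ f) :
    -- the warped product is almost product semi-regular
    IsAPSemiRegular ((𝓡 m).prod (𝓡 n)) (warpedMetric (𝓡 m) (𝓡 n) gB gF f)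
      (prodStructure (𝓡 m) (𝓡 n) J₁ J₂) ∧
    -- it is radical-stationary if the fiber is
    (IsRadicalStationary (𝓡 n) gF →
      IsRadicalStationary ((𝓡 m).prod (𝓡 n)) (warpedMetric (𝓡 m) (𝓡 n) gB gF f)) ∧
    -- all contractions of almost product Koszul forms extend smoothly
    (∀ X Y Z T : VField ((𝓡 m).prod (𝓡 n)) (B × F),
      IsSmoothVF ((𝓡 m).prod (𝓡 n)) X → IsSmoothVF ((𝓡 m).prod (𝓡 n)) Y →
      IsSmoothVF ((𝓡 m).prod (𝓡 n)) Z → IsSmoothVF ((𝓡 m).prod (𝓡 n)) T →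
      ∃ h : B × F → ℝ, ContMDiff ((𝓡 m).prod (𝓡 n)) 𝓘(ℝ, ℝ) ∞ h ∧
        ∀ p ∈ constSignature ((𝓡 m).prod (𝓡 n)) (warpedMetric (𝓡 m) (𝓡 n) gB gF f),
          h p = apContraction ((𝓡 m).prod (𝓡 n)) (warpedMetric (𝓡 m) (𝓡 n) gB gF f)
            (prodStructure (𝓡 m) (𝓡 n) J₁ J₂) X Y Z T p) := by
  -- Local compactness and second countability make `B × F` σ-compact, as the gluing by partitions
  -- of unity requires.
  have : LocallyCompactSpace B := Manifold.locallyCompact_of_finiteDimensional (𝓡 m)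
  have : LocallyCompactSpace F := Manifold.locallyCompact_of_finiteDimensional (𝓡 n)
  have h := isAPSemiRegular_warpedMetric hB hnd hF hf
  exact ⟨h,
    fun hF' => isRadicalStationary_warpedMetric hB.metric hnd hF.almostProduct.metric hF' hf,
    fun X Y Z T hX hY hZ hT => h.exists_contMDiff_eq_apContraction hX hY hZ hT⟩
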